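/- **Groupoids.** A groupoid $\mathcal H$ is identified with its set of arrows; $\mathcal H^0\subset\mathcal H$ is the set of units, $\mathfrak s,\mathfrak r:\mathcal H\to\mathcal H^0$ are source and range, and $fg$ is defined iff $\mathfrak s(f)=\mathfrak r(g)$. It is *discrete* if all sets $\mathfrak s^{-1}(x),\mathfrak r^{-1}(x)$ are countable, *topological* if it carries a topology for which source, range, inversion and composition are continuous ($\mathcal H^0$ has the subspace topology), and *measurable* if it is a standard Borel space, $\mathcal H^0$ and the set of composable pairs are Borel and the structure maps are Borel. A discrete measurable groupoid with a Borel probability measure $\nu$ on $\mathcal H^0$ is *pmp* if $\int|\mathfrak s^{-1}(x)\cap B|\,d\nu(x)=\int|\mathfrak r^{-1}(x)\cap B|\,d\nu(x)$ for all Borel $B\subset\mathcal H$; the common value is also denoted $\nu(B)$. $[[\mathcal H]]$ is the semigroup, under $fg=\{ab: a\in f,\ b\in g,\ \mathfrak s(a)=\mathfrak r(b)\}$, of Borel sets $f\subset \mathcal H$ on which $\mathfrak s$ and $\mathfrak r$ are Borel isomorphisms onto their images; $\mathrm{tr}_{\mathcal H}(f)=\nu(f\cap\mathcal H^0)$. A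 *bisection* is an open $U\subset\mathcal H$ on which $\mathfrak s$ and $\mathfrak r$ are homeomorphisms onto open subsets of $\mathcal H^0$; a groupoid is *étale* if bisections cover it. $[\mathcal H]_{top}$ is the set of bisections $U$ with $\mathfrak s(U)=\mathfrak r(U)=\mathcal H^0$. $[[\mathcal H]]_{top}$ is the set of $f\in[[\mathcal H]]$ of the form $f=\bigcup_{i=1}^n f_i$ such that for each $i$ there is a bisection $U_i$ with $\overline{f_i}\subset U_i$, $\overline{\mathfrak s(f_i)}\subset\mathfrak s(U_i)$, $\overline{\mathfrak r(f_i)}\subset\mathfrak r(U_i)$, the sets $\mathfrak s(f_i)$ are pairwise disjoint, the sets $\mathfrak r(f_i)$ are pairwise disjoint, and all of them are Borel with $\nu$-null boundary. **Sofic approximations.** $[[d]]$ is the semigroup of partial bijections $f$ of $\{1,\dots,d\}$, viewed as sets of pairs $(j,i)$ with $j=f(i)$; $|E|_d=|E|/d$ and $\mathrm{tr}_d(f)=|\{i:f(i)=i\}|/d$. $\mathrm{Map}([[\mathcal H]],[[d]])$ carries the product $\sigma$-algebra. For finite $F\subset[[\mathcal H]]$ and $\delta>0$, $\sigma$ is *$(F,\delta)$-multiplicative*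 if $|\sigma(st)\,\Delta\,\sigma(s)\sigma(t)|_d<\delta$ for $s,t\in F$, and *$(F,\delta)$-trace-preserving* if $|\mathrm{tr}_d(\sigma(s))-\mathrm{tr}_{\mathcal H}(s)|<\delta$ for $s\in F$. A *sofic approximation* to $(\mathcal H,\nu)$ is a family $\mathbb P=(\mathbb P_j)_{j\in J}$, $J$ a nonempty directed set, of probability measures on $\mathrm{Map}([[\mathcal H]],[[d_j]])$, $d_j\in\mathbb N$, such that for all finite $F$ and $\delta>0$: (1) $\lim_{j}\mathbb P_j(\sigma\text{ is }(F,\delta)\text{-trace-preserving})=1$; (2) for all sufficiently large $j$, $\mathbb P_j$-a.e. $\sigma$ is $(F,\delta)$-multiplicative; (3) $d_j\to\infty$; (4) if $f,f'\in[[\mathcal H]]$ and $\nu(f\Delta f')=0$, then $\sigma(f)=\sigma(f')$ for $\mathbb P_j$-a.e. $\sigma$, for every $j$. A *bias* $\beta$ is $-$, $+$, or an ultrafilter on $J$ containing all sets $\{j':j'\ge j\}$; $\lim_{j\to\beta}$ is $\liminf_{j}$, $\limsup_{j}$ or the ultralimit, in $[-\infty,\infty]$. **Setting.** Let $\mathcal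 G,\mathcal H$ be discrete separable topological groupoids with $\mathcal G^0,\mathcal H^0$ compact metrizable and $\mathcal H$ Hausdorff. Let $\pi:\mathcal G\to\mathcal H$ be a continuous class-bijective factor map, i.e. a continuous surjective groupoid morphism that maps $\mathfrak s^{-1}(a)$ bijectively onto $\mathfrak s^{-1}(\pi(a))$ and $\mathfrak r^{-1}(a)$ bijectively onto $\mathfrak r^{-1}(\pi(a))$ for each $a\in\mathcal G^0$. Let $\nu$ be a Borel probability measure on $\mathcal H^0$ making $\mathcal H$, with its Borel $\sigma$-algebra, a pmp groupoid. Let $\mathbb P$ be a sofic approximation to $(\mathcal H,\nu)$, $\beta$ a bias and $p\in[1,\infty]$. **Entropy.** For $f\subset\mathcal H$ in $[[\mathcal H]]$ or $[\mathcal H]_{top}$ and $x\in\mathcal G^0$ let $f\cdot x=\mathfrak r(g)$, where $g$ is the unique element of $\pi^{-1}(f)$ with $\mathfrak s(g)=x$, and $f\cdot x=*$ if there is none. For $x\in(\mathcal G^0)^d$ let $f\cdot x=(f\cdot x_i)_i$ and $x\circ\sigma(f)=(x_{\sigma(f)i})_i$, with $x_{\sigma(f)i}=*$ if $\sigma(f)i$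 is undefined. A continuous pseudo-metric $\rho$ on $\mathcal G^0$ is extended by $\rho(*,*)=0$, $\rho(*,x)=\rho(x,*)=\max_{y,z\in\mathcal G^0}\rho(y,z)$, and $\rho_2(x,x')=(\frac1d\sum_i\rho(x_i,x_i')^2)^{1/2}$, $\rho_\infty(x,x')=\max_i\rho(x_i,x_i')$. Let $Orb_\nu(\pi,\sigma,F,K,\delta,\rho)$ be the set of $x\in(\mathcal G^0)^d$ with $\rho_2(f\cdot x,x\circ\sigma(f))<\delta$ for $f\in F$ and $|d^{-1}\sum_ik(\pi(x_i))-\int k\,d\nu|<\delta$ for $k\in K$. Let $N_\epsilon(X,r)$ be the maximal cardinality of a subset of $X$ whose distinct points have $r$-distance $>\epsilon$. For $q\in\{2,\infty\}$ put $$h(\pi,\rho,q)=\sup_{\epsilon>0}\inf_{\delta>0}\inf_{F}\inf_{K}\lim_{j\to\beta}\frac1{d_j}\log\big\|N_\epsilon(Orb_\nu(\pi,\cdot,F,K,\delta,\rho),\rho_q)\big\|_{L^p(\mathbb P_j)}\in[-\infty,\infty],$$ with $F$ ranging over the finite subsets of $[[\mathcal H]]_{top}$ and $K$ over the finite subsets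 of $C(\mathcal H^0,\mathbb C)$, and $\log 0=-\infty$. Call $\rho$ *dynamically generating* for $\pi$ if for all $x\ne y$ in $\mathcal G^0$ there is $f\in[\mathcal H]_{top}$ with $\rho(f\cdot x,f\cdot y)>0$. **Theorem 6.7.** In this setting, if $\mathcal G$ is étale and $\rho_1,\rho_2$ are dynamically generating continuous pseudo-metrics on $\mathcal G^0$, then $$h(\pi,\rho_1,q_1)=h(\pi,\rho_2,q_2)\qquad\text{for all }q_1,q_2\in\{2,\infty\}.$$ That is, the sofic topological entropy $h_{\mathbb P}(\pi)=h^{\beta}_{\mathbb P,p}(\pi)$ depends neither on the choice of the dynamically generating continuous pseudo-metric nor on the choice of $\rho_2$ or $\rho_\infty$ in its definition. -/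

import Mathlib

open Set Filter Topology MeasureTheory
open scoped ENNReal

namespace SoficEntropy

universe u v

/-! ### Groupoids -/

/-- A groupoid, given by its set `H` of arrows. The set of objects is identified, through the
identity arrows, with a subset `unitSpace` of `H`. The composition `comp f g` is defined
if and only if `src f = rng g`. -/
class Grpd (H : Type u) where
  unitSpace : Set H
  src : H → unitSpace
  rng : H → unitSpace
  inv : H → H
  comp : (f g : H) → src f = rng g → H
  src_unit : ∀ x : unitSpace, src x = x
  rng_unit : ∀ x : unitSpace, rng x = x
  src_comp : ∀ (f g : H) (h : src f = rng g), src (comp f g h) = src g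
  rng_comp : ∀ (f g : H) (h : src f = rng g), rng (comp f g h) = rng f
  comp_assoc : ∀ (f g k : H) (h₁ : src f = rng g) (h₂ : src g = rng k),
    comp (comp f g h₁) k ((src_comp f g h₁).trans h₂) =
      comp f (comp g k h₂) (h₁.trans (rng_comp g k h₂).symm)
  comp_unit : ∀ f : H, comp f (src f) (rng_unit (src f)).symm = f
  unit_comp : ∀ f : H, comp (rng f) f (src_unit (rng f)) = f
  src_inv : ∀ f : H, src (inv f) = rng f
  rng_inv : ∀ f : H, rng (inv f) = src f
  inv_comp : ∀ f : H, comp (inv f) f (src_inv f) = src f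
  comp_inv : ∀ f : H, comp f (inv f) (rng_inv f).symm = rng f

/-- The object space `H⁰`, as a type. It carries the subspace topology and the sub-σ-algebra
of those of `H`. -/
abbrev Obj (H : Type u) [Grpd H] : Type u := ↥(Grpd.unitSpace (H := H))

/-- The set `H²` of composable pairs. -/
def composable (H : Type u) [Grpd H] : Set (H × H) :=
  {p | Grpd.src p.1 = Grpd.rng p.2}

/-- The composition map `H² → H`. -/
def compMap (H : Type u) [Grpd H] (p : composable H) : H :=
  Grpd.comp p.1.1 p.1.2 p.2

/-- The groupoid is discrete: source and range fibres are countable. -/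
def IsDiscreteGrpd (H : Type u) [Grpd H] : Prop :=
  ∀ x : Obj H, {h : H | Grpd.src h = x}.Countable ∧ {h : H | Grpd.rng h = x}.Countable

/-- A measurable groupoid: a standard Borel space of arrows with Borel structure maps. -/
class MeasurableGrpd (H : Type u) [MeasurableSpace H] [Grpd H] : Prop where
  standardBorel : StandardBorelSpace H
  measurableSet_unitSpace : MeasurableSet (Grpd.unitSpace (H := H))
  measurableSet_composable : MeasurableSet (composable H)
  measurable_src : Measurable (Grpd.src (H := H))
  measurable_rng : Measurable (Grpd.rng (H := H))
  measurable_inv : Measurable (Grpd.inv (H := H))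
  measurable_comp : Measurable (compMap H)

/-- A topological groupoid: the structure maps are continuous. -/
class TopologicalGrpd (H : Type u) [TopologicalSpace H] [Grpd H] : Prop where
  continuous_src : Continuous (Grpd.src (H := H))
  continuous_rng : Continuous (Grpd.rng (H := H))
  continuous_inv : Continuous (Grpd.inv (H := H))
  continuous_comp : Continuous (compMap H)

/-! ### Partial automorphisms: the semigroup `[[H]]` -/

/-- The product `s t = {a b : a ∈ s, b ∈ t composable}` of two sets of arrows. -/
def setComp {H : Type u} [Grpd H] (s t : Set H) : Set H :=
  {h | ∃ a ∈ s, ∃ b ∈ t, ∃ hab : Grpd.src a = Grpd.rng b, Grpd.comp a b hab = h}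

/-- A Borel set of arrows on which the source and range maps are Borel isomorphisms onto
their images. -/
structure IsPartialAut {H : Type u} [MeasurableSpace H] [Grpd H] (f : Set H) : Prop where
  measurableSet : MeasurableSet f
  src_embedding : MeasurableEmbedding (fun h : f => Grpd.src (h : H))
  rng_embedding : MeasurableEmbedding (fun h : f => Grpd.rng (h : H))

theorem eq_of_src_eq_of_comp_eq {H : Type u} [Grpd H] {a b b' : H}
    (h : Grpd.src a = Grpd.rng b) (h' : Grpd.src a = Grpd.rng b')
    (e : Grpd.comp a b h = Grpd.comp a b' h') : b = b' := by
  have key : ∀ (c : H) (hc : Grpd.src a = Grpd.rng c),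
      Grpd.comp (Grpd.inv a) (Grpd.comp a c hc)
        ((Grpd.src_inv a).trans (Grpd.rng_comp a c hc).symm) = c := by
    intro c hc
    rw [← Grpd.comp_assoc (Grpd.inv a) a c (Grpd.src_inv a) hc]
    have h1 := Grpd.inv_comp a
    have h2 := Grpd.unit_comp c
    have h3 : ∀ (y : H) (hy : Grpd.src y = Grpd.rng c), y = (Grpd.src a : H) →
        Grpd.comp y c hy = c := by
      intro y hy e
      have : y = (Grpd.rng c : H) := by rw [e, hc]
      subst this
      exact h2
    exact h3 _ _ h1
  have h3 : ∀ (y y' : H) (hy : Grpd.src (Grpd.inv a) = Grpd.rng y)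
      (hy' : Grpd.src (Grpd.inv a) = Grpd.rng y'), y = y' →
      Grpd.comp (Grpd.inv a) y hy = Grpd.comp (Grpd.inv a) y' hy' := by
    intro y y' hy hy' e
    subst e
    rfl
  rw [← key b h, ← key b' h']
  exact h3 _ _ _ _ e

/-- The product of two partial automorphisms is a partial automorphism. -/
theorem IsPartialAut.comp {H : Type u} [MeasurableSpace H] [Grpd H] [MeasurableGrpd H]
    {s t : Set H} (hs : IsPartialAut s) (ht : IsPartialAut t) :
    IsPartialAut (setComp s t) := by
  have : StandardBorelSpace H := MeasurableGrpd.standardBorel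
  have : StandardBorelSpace (composable H) :=
    (MeasurableGrpd.measurableSet_composable (H := H)).standardBorel
  have injs : ∀ a ∈ s, ∀ b ∈ s, Grpd.rng a = Grpd.rng b → a = b := fun a ha b hb e => by
    have := hs.rng_embedding.injective (a₁ := ⟨a, ha⟩) (a₂ := ⟨b, hb⟩) e
    exact congrArg Subtype.val this
  have injs' : ∀ a ∈ s, ∀ b ∈ s, Grpd.src a = Grpd.src b → a = b := fun a ha b hb e => by
    have := hs.src_embedding.injective (a₁ := ⟨a, ha⟩) (a₂ := ⟨b, hb⟩) e
    exact congrArg Subtype.val this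
  have injt : ∀ a ∈ t, ∀ b ∈ t, Grpd.src a = Grpd.src b → a = b := fun a ha b hb e => by
    have := ht.src_embedding.injective (a₁ := ⟨a, ha⟩) (a₂ := ⟨b, hb⟩) e
    exact congrArg Subtype.val this
  have injt' : ∀ a ∈ t, ∀ b ∈ t, Grpd.rng a = Grpd.rng b → a = b := fun a ha b hb e => by
    have := ht.rng_embedding.injective (a₁ := ⟨a, ha⟩) (a₂ := ⟨b, hb⟩) e
    exact congrArg Subtype.val this
  have himg : setComp s t =
      compMap H '' {p : composable H | p.1.1 ∈ s ∧ p.1.2 ∈ t} := by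
    ext h
    constructor
    · rintro ⟨a, ha, b, hb, hab, rfl⟩
      exact ⟨⟨(a, b), hab⟩, ⟨ha, hb⟩, rfl⟩
    · rintro ⟨⟨⟨a, b⟩, hab⟩, ⟨ha, hb⟩, rfl⟩
      exact ⟨a, ha, b, hb, hab, rfl⟩
  have hmeas : MeasurableSet (setComp s t) := by
    rw [himg]
    refine MeasurableSet.image_of_measurable_injOn ?_ MeasurableGrpd.measurable_comp ?_
    · exact (hs.measurableSet.preimage (measurable_fst.comp measurable_subtype_coe)).inter
        (ht.measurableSet.preimage (measurable_snd.comp measurable_subtype_coe))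
    · rintro ⟨⟨a, b⟩, hab⟩ ⟨ha, hb⟩ ⟨⟨a', b'⟩, hab'⟩ ⟨ha', hb'⟩ e
      have e' : Grpd.comp a b hab = Grpd.comp a' b' hab' := e
      have ea : a = a' := injs a ha a' ha' (by
        rw [← Grpd.rng_comp a b hab, ← Grpd.rng_comp a' b' hab', e'])
      subst ea
      have eb : b = b' := eq_of_src_eq_of_comp_eq hab hab' e'
      subst eb
      rfl
  have : StandardBorelSpace (setComp s t) := hmeas.standardBorel
  refine ⟨hmeas, ?_, ?_⟩
  · refine (MeasurableGrpd.measurable_src.comp measurable_subtype_coe).measurableEmbedding ?_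
    rintro ⟨_, a, ha, b, hb, hab, rfl⟩ ⟨_, a', ha', b', hb', hab', rfl⟩ e
    have e' : Grpd.src b = Grpd.src b' := by
      rw [← Grpd.src_comp a b hab, ← Grpd.src_comp a' b' hab']
      exact e
    have eb := injt b hb b' hb' e'
    subst eb
    have ea := injs' a ha a' ha' (hab.trans hab'.symm)
    subst ea
    rfl
  · refine (MeasurableGrpd.measurable_rng.comp measurable_subtype_coe).measurableEmbedding ?_
    rintro ⟨_, a, ha, b, hb, hab, rfl⟩ ⟨_, a', ha', b', hb', hab', rfl⟩ e
    have e' : Grpd.rng a = Grpd.rng a' := by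
      rw [← Grpd.rng_comp a b hab, ← Grpd.rng_comp a' b' hab']
      exact e
    have ea := injs a ha a' ha' e'
    subst ea
    have eb := injt' b hb b' hb' (hab.symm.trans hab')
    subst eb
    rfl

/-- The semigroup `[[H]]` of partial automorphisms. -/
def PartialAut (H : Type u) [MeasurableSpace H] [Grpd H] : Type u :=
  {f : Set H // IsPartialAut f}

instance instMulPartialAut (H : Type u) [MeasurableSpace H] [Grpd H] [MeasurableGrpd H] :
    Mul (PartialAut H) :=
  ⟨fun s t => ⟨setComp s.1 t.1, s.2.comp t.2⟩⟩

/-! ### Invariant measures -/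

/-- The measure of a set `B` of arrows: `ν(B) = ∫ |s⁻¹(x) ∩ B| dν(x)`. -/
noncomputable def srcMass {H : Type u} [MeasurableSpace H] [Grpd H] (ν : Measure (Obj H))
    (B : Set H) : ℝ≥0∞ :=
  ∫⁻ x, (({h : H | Grpd.src h = x} ∩ B).encard : ℝ≥0∞) ∂ν

/-- The measure `∫ |r⁻¹(x) ∩ B| dν(x)` of a set `B` of arrows. -/
noncomputable def rngMass {H : Type u} [MeasurableSpace H] [Grpd H] (ν : Measure (Obj H))
    (B : Set H) : ℝ≥0∞ :=
  ∫⁻ x, (({h : H | Grpd.rng h = x} ∩ B).encard : ℝ≥0∞) ∂ν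

/-- `(H, ν)` is a discrete probability-measure-preserving groupoid. -/
structure IsPMP (H : Type u) [MeasurableSpace H] [Grpd H] [MeasurableGrpd H]
    (ν : Measure (Obj H)) : Prop where
  discrete : IsDiscreteGrpd H
  prob : IsProbabilityMeasure ν
  invariant : ∀ B : Set H, MeasurableSet B → srcMass ν B = rngMass ν B

/-- The trace `ν(H⁰ ∩ f)`. -/
noncomputable def trace {H : Type u} [MeasurableSpace H] [Grpd H] (ν : Measure (Obj H))
    (f : PartialAut H) : ℝ :=
  ν.real {x : Obj H | (x : H) ∈ f.1}

/-! ### Bisections, `[H]_top`, `[[H]]_top` -/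

/-- A bisection: an open set of arrows on which source and range are homeomorphisms onto
open subsets of `H⁰`. -/
structure IsBisection {H : Type u} [TopologicalSpace H] [Grpd H] (U : Set H) : Prop where
  isOpen : IsOpen U
  src_embedding : IsOpenEmbedding (fun h : U => Grpd.src (h : H))
  rng_embedding : IsOpenEmbedding (fun h : U => Grpd.rng (h : H))

/-- The groupoid is étale: every arrow lies in a bisection. -/
def IsEtale (H : Type u) [TopologicalSpace H] [Grpd H] : Prop :=
  ∀ g : H, ∃ U : Set H, IsBisection U ∧ g ∈ U

/-- Membership in `[H]_top`: bisections whose source and range are all of `H⁰`. -/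
def IsFullBisection {H : Type u} [TopologicalSpace H] [Grpd H] (U : Set H) : Prop :=
  IsBisection U ∧ Grpd.src '' U = univ ∧ Grpd.rng '' U = univ

/-- Membership in `B_∂(H⁰, ν)`: Borel sets with `ν`-null boundary. -/
def NullBoundary {X : Type u} [TopologicalSpace X] [MeasurableSpace X] (ν : Measure X)
    (A : Set X) : Prop :=
  MeasurableSet A ∧ ν (frontier A) = 0

/-- Membership in `[[H]]_top`. -/
def IsTop {H : Type u} [TopologicalSpace H] [MeasurableSpace H] [Grpd H]
    (ν : Measure (Obj H)) (f : PartialAut H) : Prop :=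
  ∃ (n : ℕ) (g : Fin n → Set H), f.1 = ⋃ i, g i ∧
    (∀ i, ∃ U : Set H, IsBisection U ∧ closure (g i) ⊆ U ∧
      closure (Grpd.src '' g i) ⊆ Grpd.src '' U ∧ closure (Grpd.rng '' g i) ⊆ Grpd.rng '' U) ∧
    (∀ i, NullBoundary ν (Grpd.src '' g i)) ∧
    (∀ i, NullBoundary ν (Grpd.rng '' g i)) ∧
    Pairwise (fun i j => Disjoint (Grpd.src '' g i) (Grpd.src '' g j)) ∧
    Pairwise (fun i j => Disjoint (Grpd.rng '' g i) (Grpd.rng '' g j))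

/-! ### Sofic approximations

The semigroup `[[d]]` of partial automorphisms of the full groupoid on `d` points is the set of
partial bijections `Fin d ≃. Fin d`; the pair `(j, i)`, with source `i` and range `j`, belongs to
`f` if and only if `f i = some j`. The product `f g` is `g.trans f`. -/

/-- The set of arrows `(j, i)` of a partial bijection. -/
def graph {d : ℕ} (f : Fin d ≃. Fin d) : Set (Fin d × Fin d) :=
  {q | f q.2 = some q.1}

/-- The normalized cardinality `|E|_d = |E| / d`. -/
noncomputable def normCard (d : ℕ) (E : Set (Fin d × Fin d)) : ℝ :=
  (E.ncard : ℝ) / d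

/-- The normalized number `tr_d(f)` of fixed points. -/
noncomputable def traceFin {d : ℕ} (f : Fin d ≃. Fin d) : ℝ :=
  normCard d (graph f ∩ {q | q.1 = q.2})

instance instMeasurableSpacePEquiv (d : ℕ) : MeasurableSpace (Fin d ≃. Fin d) := ⊤

/-- `Map([[H]], [[d]])`. Its σ-algebra is the product σ-algebra, which is generated by the
finite cylinders since `[[d]]` is a finite discrete space. -/
abbrev SoficMap (H : Type u) [MeasurableSpace H] [Grpd H] (d : ℕ) : Type u :=
  PartialAut H → (Fin d ≃. Fin d)

/-- `σ` is `(F, δ)`-multiplicative. -/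
def IsMultiplicative {H : Type u} [MeasurableSpace H] [Grpd H] [MeasurableGrpd H] {d : ℕ}
    (F : Finset (PartialAut H)) (δ : ℝ) (σ : SoficMap H d) : Prop :=
  ∀ s ∈ F, ∀ t ∈ F,
    normCard d (symmDiff (graph (σ (s * t))) (graph ((σ t).trans (σ s)))) < δ

/-- `σ` is `(F, δ)`-trace-preserving. -/
def IsTracePreserving {H : Type u} [MeasurableSpace H] [Grpd H] {d : ℕ}
    (ν : Measure (Obj H)) (F : Finset (PartialAut H)) (δ : ℝ) (σ : SoficMap H d) : Prop :=
  ∀ s ∈ F, |traceFin (σ s) - trace ν s| < δ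

/-- `(P_j)` is a (random) sofic approximation to `(H, ν)`. -/
structure IsSoficApproximation {H : Type u} [MeasurableSpace H] [Grpd H] [MeasurableGrpd H]
    (ν : Measure (Obj H)) {J : Type v} [Preorder J] (d : J → ℕ)
    (P : ∀ j, Measure (SoficMap H (d j))) : Prop where
  prob : ∀ j, IsProbabilityMeasure (P j)
  trace_preserving : ∀ (F : Finset (PartialAut H)) (δ : ℝ), 0 < δ →
    Tendsto (fun j => P j {σ | IsTracePreserving ν F δ σ}) atTop (𝓝 1)
  multiplicative : ∀ (F : Finset (PartialAut H)) (δ : ℝ), 0 < δ →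
    ∃ j, ∀ j', j ≤ j' → ∀ᵐ σ ∂(P j'), IsMultiplicative F δ σ
  tendsto_size : Tendsto d atTop atTop
  ae_eq : ∀ f f' : PartialAut H, srcMass ν (symmDiff f.1 f'.1) = 0 →
    ∀ j, ∀ᵐ σ ∂(P j), σ f = σ f'

/-- A bias for the directed set `J`: one of the signs `-`, `+`, or an ultrafilter on `J`
containing all the tails of `J`. -/
inductive Bias (J : Type v) [Preorder J] : Type v
  | minus : Bias J
  | plus : Bias J
  | ultra (β : Ultrafilter J) (hβ : ∀ j : J, Ici j ∈ β) : Bias J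

/-- The limit along a bias: the lower limit, the upper limit, or the limit along the
ultrafilter (which exists, as the extended real line is compact). -/
noncomputable def Bias.lim {J : Type v} [Preorder J] : Bias J → (J → EReal) → EReal
  | .minus, Φ => liminf Φ atTop
  | .plus, Φ => limsup Φ atTop
  | .ultra β _, Φ => (β.map Φ).lim

/-! ### Class-bijective extensions -/

/-- A groupoid morphism. -/
structure IsMorphism {G : Type u} {H : Type v} [Grpd G] [Grpd H] (π : G → H) : Prop where
  map_unit : ∀ x : Obj G, π x ∈ Grpd.unitSpace (H := H)
  map_comp : ∀ (f g : G) (h : Grpd.src f = Grpd.rng g),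
    ∃ h' : Grpd.src (π f) = Grpd.rng (π g), π (Grpd.comp f g h) = Grpd.comp (π f) (π g) h'
  map_inv : ∀ f : G, π (Grpd.inv f) = Grpd.inv (π f)

/-- The map `G⁰ → H⁰` induced by a groupoid morphism. -/
def IsMorphism.onObj {G : Type u} {H : Type v} [Grpd G] [Grpd H] {π : G → H}
    (hπ : IsMorphism π) (x : Obj G) : Obj H :=
  ⟨π x, hπ.map_unit x⟩

/-- A class-bijective factor map: a surjective morphism which is bijective on source fibres and
on range fibres. -/
structure IsClassBijectiveFactor {G : Type u} {H : Type v} [Grpd G] [Grpd H] (π : G → H) :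
    Prop extends IsMorphism π where
  surjective : Function.Surjective π
  src_bij : ∀ a : Obj G,
    BijOn π {g | Grpd.src g = a} {h | Grpd.src h = toIsMorphism.onObj a}
  rng_bij : ∀ a : Obj G,
    BijOn π {g | Grpd.rng g = a} {h | Grpd.rng h = toIsMorphism.onObj a}

/-! ### Approximate partial orbits -/

open Classical in
/-- `f · x = r(f x)`, with value `none` (the symbol `*`) if `x` is not in the source of `f`. -/
noncomputable def act {G : Type u} [Grpd G] (f : Set G) (x : Obj G) : Option (Obj G) :=
  if h : ∃ g ∈ f, Grpd.src g = x then some (Grpd.rng h.choose) else none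

/-- The extension of a pseudo-metric on `X` to `X ∪ {*}` for which `*` has distance
`max ρ` to every point of `X`. -/
noncomputable def extDist {X : Type u} (ρ : PseudoMetric X ℝ) : Option X → Option X → ℝ
  | some x, some y => ρ x y
  | none, none => 0
  | _, _ => ⨆ p : X × X, ρ p.1 p.2

/-- The two ways of comparing `d`-tuples. -/
inductive TupleDist : Type
  | two : TupleDist
  | infty : TupleDist

/-- The pseudo-metrics `ρ₂` and `ρ_∞` on `(X ∪ {*})^d`. -/
noncomputable def tupleDist {X : Type u} (ρ : PseudoMetric X ℝ) {d : ℕ} :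
    TupleDist → (Fin d → Option X) → (Fin d → Option X) → ℝ
  | .two, x, y => Real.sqrt ((1 / (d : ℝ)) * ∑ i, extDist ρ (x i) (y i) ^ 2)
  | .infty, x, y => ⨆ i, extDist ρ (x i) (y i)

/-- The set `Orb_ν(π, σ, F, K, δ, ρ)` of approximate partial orbits. -/
def Orb {G : Type u} {H : Type v} [Grpd G] [TopologicalSpace H] [MeasurableSpace H] [Grpd H]
    (ν : Measure (Obj H)) {π : G → H} (hπ : IsMorphism π) {d : ℕ} (σ : SoficMap H d)
    (F : Finset (PartialAut H)) (K : Finset C(Obj H, ℂ)) (δ : ℝ) (ρ : PseudoMetric (Obj G) ℝ) :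
    Set (Fin d → Obj G) :=
  {x | (∀ f ∈ F, tupleDist ρ .two (fun i => act (π ⁻¹' f.1) (x i))
          (fun i => (σ f i).map x) < δ) ∧
    ∀ k ∈ K, ‖(d : ℂ)⁻¹ * ∑ i, k (hπ.onObj (x i)) - ∫ y, k y ∂ν‖ < δ}

/-- `N_ε(X, r)`: the maximal cardinality of an `(r, ε)`-separated subset of `X`. -/
noncomputable def sepNumber {Z : Type u} (r : Z → Z → ℝ) (ε : ℝ) (X : Set Z) : ℕ∞ :=
  ⨆ (Y : Set Z) (_ : Y ⊆ X ∧ Y.Pairwise fun y₁ y₂ => ε < r y₁ y₂), Y.encard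

/-! ### Topological entropy -/

/-- `h^β_{P,p}(π, ρ, 2)` and `h^β_{P,p}(π, ρ, ∞)`, with values in the extended reals. -/
noncomputable def entropy {G : Type u} {H : Type v} [Grpd G] [TopologicalSpace H]
    [MeasurableSpace H] [Grpd H] (ν : Measure (Obj H)) {J : Type*} [Preorder J] (d : J → ℕ)
    (P : ∀ j, Measure (SoficMap H (d j))) (β : Bias J) (p : ℝ≥0∞) {π : G → H}
    (hπ : IsMorphism π) (ρ : PseudoMetric (Obj G) ℝ) (q : TupleDist) : EReal :=
  ⨆ (ε : ℝ) (_ : 0 < ε), ⨅ (δ : ℝ) (_ : 0 < δ),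
    ⨅ (F : Finset (PartialAut H)) (_ : ∀ f ∈ F, IsTop ν f), ⨅ K : Finset C(Obj H, ℂ),
      β.lim fun j =>
        ENNReal.log (eLpNorm (fun σ : SoficMap H (d j) =>
          (sepNumber (fun x y : Fin (d j) → Obj G =>
            tupleDist ρ q (fun i => some (x i)) (fun i => some (y i))) ε
            (Orb ν hπ σ F K δ ρ) : ℝ≥0∞)) p (P j)) / (d j : EReal)

/-- The pseudo-metric is continuous. -/
def IsContinuous {X : Type u} [TopologicalSpace X] (ρ : PseudoMetric X ℝ) : Prop :=
  Continuous fun p : X × X => ρ p.1 p.2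

/-- The pseudo-metric `ρ` on `G⁰` is dynamically generating for `π : G → H`. -/
def IsDynGenerating {G : Type u} {H : Type v} [Grpd G] [TopologicalSpace H] [Grpd H]
    (π : G → H) (ρ : PseudoMetric (Obj G) ℝ) : Prop :=
  ∀ x y : Obj G, x ≠ y → ∃ U : Set H, IsFullBisection U ∧
    0 < extDist ρ (act (π ⁻¹' U) x) (act (π ⁻¹' U) y)

end SoficEntropy

open SoficEntropy

namespace SoficEntropy

universe u v

/-! ### Comparison of entropies -/

/-! Two comparisons of separated-set counts give the result: one changes `q` for a fixed
pseudo-metric, the other changes the pseudo-metric for `q = 2`. In each, the count on the left is at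
most `exp (κ n)` times a count on the right with other parameters, for every `κ > 0`.
`entropy_le_entropy` turns this into an inequality of entropies.

Since `ρ₂ ≤ ρ_∞`, separation in `ρ₂` implies separation in `ρ_∞`. Conversely
(`exists_sepNumber_infty_le`), a tuple that is `ρ₂`-close to a point of a net is, by Chebyshev,
close to it at all but a small proportion of the coordinates. The net point and a finite colouring
of the bad coordinates then determine the tuple up to `ε` in `ρ_∞`, and there are only `exp (κ n)`
such colourings.

To pass from `ρ` to `ρ'`, compactness of `G⁰` makes the generating property uniform
(`IsDynGenerating.exists_finset`): finitely many full bisections `U` and a `τ > 0` exist such that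
`ρ(U·x, U·y) < τ` for all these `U` forces `ρ'(x, y) < η`. On an approximate orbit `U·x_i` is
usually near `x_{σ(U)i}`, and `σ(U)` is injective, so `ρ₂`-closeness of two orbits persists along
every `U` and yields `ρ'₂`-closeness (`tupleDist_two_le_of_close`). Likewise `U·(f·x_i)` and
`U·x_{σ(f)i}` are usually close, because `σ(Uf)` nearly equals `σ(U)σ(f)`; hence approximate orbits
for `ρ` are approximate orbits for `ρ'` (`exists_Orb_subset`). The products `Uf` stay in `[[H]]_top`
by `IsTop.full_mul`. Exchanging the two pseudo-metrics gives equality. -/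

theorem Bias.lim_le_lim_add {J : Type v} [Preorder J] [IsDirectedOrder J] [Nonempty J]
    (β : Bias J) {Φ Ψ : J → EReal} {κ : ℝ} (h : ∀ᶠ j in atTop, Φ j ≤ Ψ j + κ) :
    β.lim Φ ≤ β.lim Ψ + κ := by
  have hmono : Monotone fun u : EReal => u + (κ : EReal) := fun a b hab => by
    dsimp only
    gcongr
  have hcont : Continuous fun u : EReal => u + (κ : EReal) := by
    refine continuous_iff_continuousAt.2 fun u => ?_
    exact (EReal.continuousAt_add (p := (u, (κ : EReal))) (Or.inr (EReal.coe_ne_bot κ))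
      (Or.inr (EReal.coe_ne_top κ))).comp (f := fun u : EReal => (u, (κ : EReal)))
      (Continuous.continuousAt (by fun_prop))
  cases β with
  | minus =>
    change liminf Φ atTop ≤ liminf Ψ atTop + κ
    rw [hmono.map_liminf_of_continuousAt Ψ hcont.continuousAt]
    exact liminf_le_liminf h
  | plus =>
    change limsup Φ atTop ≤ limsup Ψ atTop + κ
    rw [hmono.map_limsup_of_continuousAt Ψ hcont.continuousAt]
    exact limsup_le_limsup h
  | ultra β hβ =>
    have hle : (β : Filter J) ≤ atTop := le_iInf fun j => le_principal_iff.2 (hβ j)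
    have h1 : Tendsto Φ β (𝓝 (β.map Φ).lim) := (β.map Φ).le_nhds_lim
    have h2 : Tendsto Ψ β (𝓝 (β.map Ψ).lim) := (β.map Ψ).le_nhds_lim
    exact le_of_tendsto_of_tendsto h1 ((hcont.tendsto _).comp h2) (h.filter_mono hle)

/-- The `L^p` norm is monotone and homogeneous, so a factor `exp (κ n)` inside it costs exactly `κ`
after taking the logarithm and dividing by `n`. -/
theorem log_eLpNorm_div_le {Ω : Type u} [MeasurableSpace Ω] {μ : Measure Ω} {p : ℝ≥0∞}
    {M N : Ω → ℝ≥0∞} {n : ℕ} (hn : 0 < n) {κ : ℝ}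
    (h : ∀ᵐ ω ∂μ, M ω ≤ ENNReal.ofReal (Real.exp (κ * n)) * N ω) :
    ENNReal.log (eLpNorm M p μ) / (n : EReal) ≤ ENNReal.log (eLpNorm N p μ) / (n : EReal) + κ := by
  have h1 : eLpNorm M p μ ≤ ENNReal.ofReal (Real.exp (κ * n)) * eLpNorm N p μ :=
    eLpNorm_le_mul_eLpNorm_of_ae_le_mul' (c := (Real.exp (κ * n)).toNNReal) (f := M) (g := N) h p
  have hn0 : (0 : EReal) < n := by exact_mod_cast hn
  have h2 := ENNReal.log_monotone h1
  rw [ENNReal.log_mul_add, ENNReal.log_ofReal_of_pos (Real.exp_pos _), Real.log_exp] at h2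
  refine (EReal.div_le_div_right_of_nonneg hn0.le h2).trans (le_of_eq ?_)
  rw [EReal.add_div_of_nonneg_right hn0.le, add_comm]
  congr 1
  have h3 : (n : EReal) = ((n : ℝ) : EReal) := rfl
  rw [h3, ← EReal.coe_div]
  congr 1
  have : (n : ℝ) ≠ 0 := by positivity
  field_simp

section
variable {G : Type u} {H : Type v} [Grpd G] [TopologicalSpace H]
    [MeasurableSpace H] [Grpd H] {ν : Measure (Obj H)}
    {J : Type*} [Preorder J] [IsDirectedOrder J] [Nonempty J] {d : J → ℕ}
    {P : ∀ j, Measure (SoficMap H (d j))} {π : G → H}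

/-- The number of `ε`-separated approximate partial orbits. -/
noncomputable def orbNumber (ν : Measure (Obj H)) (hπ : IsMorphism π) {n : ℕ} (σ : SoficMap H n)
    (F : Finset (PartialAut H)) (K : Finset C(Obj H, ℂ)) (δ : ℝ) (ρ : PseudoMetric (Obj G) ℝ)
    (q : TupleDist) (ε : ℝ) : ℕ∞ :=
  sepNumber (fun x y : Fin n → Obj G =>
    tupleDist ρ q (fun i => some (x i)) (fun i => some (y i))) ε (Orb ν hπ σ F K δ ρ)

/-- The quantifiers mirror the sup-inf in the definition: `ε'` answers `ε` and `κ`, and only then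
are `δ, F, K` found for given `δ', F', K'`. The guard `0 < d j` costs nothing, since `d` tends to
infinity. -/
theorem entropy_le_entropy (hd : Tendsto d atTop atTop) (β : Bias J) (p : ℝ≥0∞)
    (hπ : IsMorphism π) {ρ₁ ρ₂ : PseudoMetric (Obj G) ℝ} {q₁ q₂ : TupleDist}
    (h : ∀ ε : ℝ, 0 < ε → ∀ κ : ℝ, 0 < κ → ∃ ε' : ℝ, 0 < ε' ∧ ∀ δ' : ℝ, 0 < δ' →
      ∀ F' : Finset (PartialAut H), (∀ f ∈ F', IsTop ν f) → ∀ K' : Finset C(Obj H, ℂ),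
      ∃ δ : ℝ, 0 < δ ∧ ∃ F : Finset (PartialAut H), (∀ f ∈ F, IsTop ν f) ∧
      ∃ K : Finset C(Obj H, ℂ), ∀ᶠ j in atTop, 0 < d j → ∀ᵐ σ ∂(P j),
        (orbNumber ν hπ σ F K δ ρ₁ q₁ ε : ℝ≥0∞) ≤
          ENNReal.ofReal (Real.exp (κ * d j)) * (orbNumber ν hπ σ F' K' δ' ρ₂ q₂ ε' : ℝ≥0∞)) :
    entropy ν d P β p hπ ρ₁ q₁ ≤ entropy ν d P β p hπ ρ₂ q₂ := by
  refine iSup₂_le fun ε hε => EReal.le_of_forall_lt_iff_le.1 fun c hc => ?_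
  -- Comparing with reals `c' < c` above the right-hand entropy handles infinite values: a loss of
  -- `κ = c - c'` still leaves the bound `c`.
  obtain ⟨c', hc1, hc2⟩ := EReal.lt_iff_exists_real_btwn.1 hc
  have hκ : 0 < c - c' := sub_pos.2 (EReal.coe_lt_coe_iff.1 hc2)
  obtain ⟨ε', hε', h'⟩ := h ε hε (c - c') hκ
  have key : ∀ a : EReal, (∀ (δ' : ℝ), 0 < δ' →
      ∀ F' : Finset (PartialAut H), (∀ f ∈ F', IsTop ν f) → ∀ K' : Finset C(Obj H, ℂ),
      a ≤ β.lim (fun j => ENNReal.log (eLpNorm (fun σ : SoficMap H (d j) =>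
          (orbNumber ν hπ σ F' K' δ' ρ₂ q₂ ε' : ℝ≥0∞)) p (P j)) / (d j : EReal))) →
      a ≤ entropy ν d P β p hπ ρ₂ q₂ := fun a ha =>
    le_iSup₂_of_le ε' hε' (le_iInf₂ fun δ' hδ' => le_iInf₂ fun F' hF' => le_iInf fun K' =>
      ha δ' hδ' F' hF' K')
  set E := ⨅ (δ : ℝ) (_ : 0 < δ),
    ⨅ (F : Finset (PartialAut H)) (_ : ∀ f ∈ F, IsTop ν f), ⨅ K : Finset C(Obj H, ℂ),
      β.lim fun j =>
        ENNReal.log (eLpNorm (fun σ : SoficMap H (d j) =>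
          (sepNumber (fun x y : Fin (d j) → Obj G =>
            tupleDist ρ₁ q₁ (fun i => some (x i)) (fun i => some (y i))) ε
            (Orb ν hπ σ F K δ ρ₁) : ℝ≥0∞)) p (P j)) / (d j : EReal) with hE
  have hsub : E - ((c - c' : ℝ) : EReal) ≤ entropy ν d P β p hπ ρ₂ q₂ := by
    refine key _ fun δ' hδ' F' hF' K' => ?_
    obtain ⟨δ, hδ, F, hF, K, hev⟩ := h' δ' hδ' F' hF' K'
    refine EReal.sub_le_of_le_add ?_
    refine (iInf₂_le_of_le δ hδ (iInf₂_le_of_le F hF (iInf_le _ K))).trans ?_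
    refine β.lim_le_lim_add ?_
    filter_upwards [hev, hd.eventually_gt_atTop 0] with j hj hdj
    exact log_eLpNorm_div_le hdj (hj hdj)
  have h3 : E ≤ entropy ν d P β p hπ ρ₂ q₂ + ((c - c' : ℝ) : EReal) :=
    (EReal.sub_le_iff_le_add (Or.inl (EReal.coe_ne_bot _)) (Or.inl (EReal.coe_ne_top _))).1 hsub
  refine h3.trans ?_
  calc _ ≤ (c' : EReal) + ((c - c' : ℝ) : EReal) := by gcongr
    _ = c := by rw [← EReal.coe_add]; congr 1; ring

end

/-! ### Distances between tuples -/

section Distances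

variable {X : Type u} {ρ : PseudoMetric X ℝ}

/-- The diameter of a pseudo-metric. -/
noncomputable def pdiam (ρ : PseudoMetric X ℝ) : ℝ := ⨆ p : X × X, ρ p.1 p.2

theorem IsContinuous.bddAbove [TopologicalSpace X] [CompactSpace X] (hρ : IsContinuous ρ) :
    BddAbove (range fun p : X × X => ρ p.1 p.2) :=
  (isCompact_range hρ).bddAbove

theorem pdiam_nonneg (ρ : PseudoMetric X ℝ) : 0 ≤ pdiam ρ :=
  Real.iSup_nonneg fun _ => PseudoMetric.nonneg ρ _ _

theorem le_pdiam (hb : BddAbove (range fun p : X × X => ρ p.1 p.2)) (x y : X) :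
    ρ x y ≤ pdiam ρ :=
  le_ciSup hb (x, y)

theorem extDist_nonneg (x y : Option X) : 0 ≤ extDist ρ x y := by
  rcases x with _ | x <;> rcases y with _ | y
  · exact le_rfl
  · exact pdiam_nonneg ρ
  · exact pdiam_nonneg ρ
  · exact PseudoMetric.nonneg ρ _ _

theorem extDist_le_pdiam (hb : BddAbove (range fun p : X × X => ρ p.1 p.2)) (x y : Option X) :
    extDist ρ x y ≤ pdiam ρ := by
  rcases x with _ | x <;> rcases y with _ | y
  · exact pdiam_nonneg ρ
  · exact le_rfl
  · exact le_rfl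
  · exact le_pdiam hb _ _

theorem extDist_self (x : Option X) : extDist ρ x x = 0 := by
  rcases x with _ | x
  · rfl
  · exact PseudoMetric.refl ρ x

theorem extDist_comm (x y : Option X) : extDist ρ x y = extDist ρ y x := by
  rcases x with _ | x <;> rcases y with _ | y
  · rfl
  · rfl
  · rfl
  · exact PseudoMetric.symm ρ x y

theorem extDist_triangle (hb : BddAbove (range fun p : X × X => ρ p.1 p.2)) (x y z : Option X) :
    extDist ρ x z ≤ extDist ρ x y + extDist ρ y z := by
  have hM := pdiam_nonneg ρ
  rcases x with _ | x <;> rcases y with _ | y <;> rcases z with _ | z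
  · exact (add_zero _).ge
  · exact (zero_add _).ge
  · exact add_nonneg hM hM
  · exact le_add_of_nonneg_right (PseudoMetric.nonneg ρ y z)
  · exact (add_zero _).ge
  · exact (le_pdiam hb x z).trans (le_add_of_nonneg_left hM)
  · exact le_add_of_nonneg_left (PseudoMetric.nonneg ρ x y)
  · exact PseudoMetric.triangle ρ x y z

/-- Chebyshev's inequality for the normalized counting measure. -/
theorem card_le_of_tupleDist_two_le {n : ℕ} {x y : Fin n → Option X} {c δ : ℝ} (hc : 0 < c)
    (h : tupleDist ρ .two x y ≤ δ) :
    (({i | c ≤ extDist ρ (x i) (y i)} : Finset (Fin n)).card : ℝ) ≤ (δ / c) ^ 2 * n := by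
  rcases Nat.eq_zero_or_pos n with rfl | hn
  · simp
  have hn' : (0 : ℝ) < n := by exact_mod_cast hn
  have hδ : 0 ≤ δ := (Real.sqrt_nonneg _).trans h
  have h1 : (1 / (n : ℝ)) * ∑ i, extDist ρ (x i) (y i) ^ 2 ≤ δ ^ 2 :=
    (Real.sqrt_le_left hδ).1 h
  have h2 : (({i | c ≤ extDist ρ (x i) (y i)} : Finset (Fin n)).card : ℝ) * c ^ 2 ≤
      ∑ i, extDist ρ (x i) (y i) ^ 2 := by
    rw [← nsmul_eq_mul]
    refine (Finset.card_nsmul_le_sum _ (fun i => extDist ρ (x i) (y i) ^ 2) _ fun i hi => ?_).trans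
      (Finset.sum_le_sum_of_subset_of_nonneg (Finset.subset_univ _) fun i _ _ => sq_nonneg _)
    exact pow_le_pow_left₀ hc.le (Finset.mem_filter.1 hi).2 2
  have h3 : ∑ i, extDist ρ (x i) (y i) ^ 2 ≤ δ ^ 2 * n := by
    rw [one_div, inv_mul_le_iff₀ hn'] at h1
    linarith
  rw [div_pow, div_mul_eq_mul_div, le_div_iff₀ (by positivity)]
  exact h2.trans h3

/-- A converse to Chebyshev: good coordinates contribute at most `η ^ 2` each, exceptional ones at
most the squared diameter. -/
theorem tupleDist_two_le {n : ℕ} (hb : BddAbove (range fun p : X × X => ρ p.1 p.2))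
    {x y : Fin n → Option X} {η θ : ℝ} (hθ : 0 ≤ θ) {B : Finset (Fin n)}
    (hB : (B.card : ℝ) ≤ θ * n) (h : ∀ i ∉ B, extDist ρ (x i) (y i) ≤ η) :
    tupleDist ρ .two x y ≤ Real.sqrt (η ^ 2 + pdiam ρ ^ 2 * θ) := by
  refine Real.sqrt_le_sqrt ?_
  rcases Nat.eq_zero_or_pos n with rfl | hn
  · simp
    positivity
  have hn' : (0 : ℝ) < n := by exact_mod_cast hn
  rw [one_div, inv_mul_le_iff₀ hn']
  calc ∑ i, extDist ρ (x i) (y i) ^ 2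
      ≤ ∑ i : Fin n, (η ^ 2 + if i ∈ B then pdiam ρ ^ 2 else 0) := by
        refine Finset.sum_le_sum fun i _ => ?_
        split_ifs with hi
        · have := pow_le_pow_left₀ (extDist_nonneg _ _) (extDist_le_pdiam hb (x i) (y i)) 2
          linarith [sq_nonneg η]
        · have := pow_le_pow_left₀ (extDist_nonneg _ _) (h i hi) 2
          linarith
    _ = n * η ^ 2 + B.card * pdiam ρ ^ 2 := by
        rw [Finset.sum_add_distrib, Finset.sum_ite_mem]
        simp
    _ ≤ n * (η ^ 2 + pdiam ρ ^ 2 * θ) := by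
        have := mul_le_mul_of_nonneg_right hB (sq_nonneg (pdiam ρ))
        linarith

theorem extDist_le_tupleDist_infty {n : ℕ} (x y : Fin n → Option X) (i : Fin n) :
    extDist ρ (x i) (y i) ≤ tupleDist ρ .infty x y :=
  le_ciSup (f := fun i => extDist ρ (x i) (y i)) (finite_range _).bddAbove i

theorem tupleDist_two_le_infty {n : ℕ} (x y : Fin n → Option X) :
    tupleDist ρ .two x y ≤ tupleDist ρ .infty x y := by
  have h0 : 0 ≤ tupleDist ρ .infty x y := Real.iSup_nonneg fun i => extDist_nonneg _ _
  refine (Real.sqrt_le_left h0).2 ?_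
  rcases Nat.eq_zero_or_pos n with rfl | hn
  · simp
    positivity
  have hn' : (0 : ℝ) < n := by exact_mod_cast hn
  rw [one_div, inv_mul_le_iff₀ hn']
  refine (Finset.sum_le_card_nsmul _ _ _ fun i _ =>
    pow_le_pow_left₀ (extDist_nonneg _ _) (extDist_le_tupleDist_infty x y i) 2).trans ?_
  simp

end Distances

/-! ### Separated sets -/

theorem sepNumber_le_sepNumber {Z : Type u} {r r' : Z → Z → ℝ} {ε ε' : ℝ} {X X' : Set Z}
    (hX : X ⊆ X') (h : ∀ x ∈ X, ∀ y ∈ X, ε < r x y → ε' < r' x y) :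
    sepNumber r ε X ≤ sepNumber r' ε' X' :=
  iSup₂_le fun Y hY => le_iSup₂_of_le (f := fun (Y : Set Z) _ => Y.encard) Y
    ⟨hY.1.trans hX, fun x hx y hy hne => h x (hY.1 hx) y (hY.1 hy) (hY.2 hx hy hne)⟩ le_rfl

/-- A maximal separated set, given by Zorn's lemma, is an `ε`-net: a point far from all of it could
be added. -/
theorem exists_maximal_separated {Z : Type u} (r : Z → Z → ℝ) (hr : ∀ x y, r x y = r y x)
    (hr0 : ∀ x, r x x = 0) {ε : ℝ} (hε : 0 ≤ ε) (X : Set Z) :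
    ∃ D ⊆ X, D.encard ≤ sepNumber r ε X ∧ ∀ x ∈ X, ∃ y ∈ D, r x y ≤ ε := by
  obtain ⟨D, hD⟩ := zorn_subset {Y : Set Z | Y ⊆ X ∧ Y.Pairwise fun y₁ y₂ => ε < r y₁ y₂} (by
    intro c hc hchain
    refine ⟨⋃₀ c, ⟨sUnion_subset fun Y hY => (hc hY).1, ?_⟩, fun Y hY => subset_sUnion_of_mem hY⟩
    exact (pairwise_sUnion hchain.directedOn).2 fun Y hY => (hc hY).2)
  refine ⟨D, hD.prop.1, le_iSup₂_of_le (f := fun (Y : Set Z) _ => Y.encard) D hD.prop le_rfl,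
    fun x hx => ?_⟩
  by_contra! hcon
  have hins : insert x D ⊆ D := hD.le_of_ge (y := insert x D) ⟨insert_subset hx hD.prop.1, by
    refine hD.prop.2.insert fun y hy hne => ⟨hcon y hy, ?_⟩
    rw [hr]
    exact hcon y hy⟩ (subset_insert x D)
  have hxD : x ∈ D := hins (mem_insert x D)
  have := hcon x hxD
  rw [hr0] at this
  linarith

/-- If a map to `A × D` is injective on separated sets, it bounds their size. -/
theorem sepNumber_le_card_mul {Z A : Type*} [Fintype A] {r : Z → Z → ℝ} {ε : ℝ} {X : Set Z}
    (D : Set Z) (P : A → Prop) [DecidablePred P] (Φ : Z → A × Z)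
    (hΦ : ∀ x ∈ X, P (Φ x).1 ∧ (Φ x).2 ∈ D)
    (hinj : ∀ x ∈ X, ∀ y ∈ X, Φ x = Φ y → r x y ≤ ε) :
    sepNumber r ε X ≤ (Finset.univ.filter P).card * D.encard := by
  refine iSup₂_le fun Y hY => ?_
  have h1 : InjOn Φ Y := by
    intro x hx y hy hxy
    by_contra hne
    exact absurd (hY.2 hx hy hne) (not_lt.2 (hinj x (hY.1 hx) y (hY.1 hy) hxy))
  have h2 : MapsTo Φ Y ((Finset.univ.filter P : Set A) ×ˢ D) := fun x hx => by
    refine mem_prod.2 ⟨?_, (hΦ x (hY.1 hx)).2⟩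
    simpa using (hΦ x (hY.1 hx)).1
  refine (encard_le_encard_of_injOn h2 h1).trans ?_
  rw [encard_prod, encard_coe_eq_coe_finsetCard]

/-! ### The entropy does not depend on the choice of `ρ₂` or `ρ_∞` -/

/-- A Chernoff bound. Weighting each non-`none` entry by `t`, all patterns together weigh `(1 + |A|
t) ^ n`, and since `t ≤ 1` a pattern with at most `m` such entries weighs at least `t ^ m`. -/
theorem card_patterns_mul_pow_le {A : Type*} [Fintype A] {n : ℕ} {t m : ℝ} (ht : 0 < t)
    (ht1 : t ≤ 1) :
    ((Finset.univ.filter fun w : Fin n → Option A =>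
      ((Finset.univ.filter fun i => w i ≠ none).card : ℝ) ≤ m).card : ℝ) * t ^ m ≤
      (1 + Fintype.card A * t) ^ n := by
  classical
  have h1 : ∑ w : Fin n → Option A, ∏ i, (if w i ≠ none then t else 1) =
      (1 + Fintype.card A * t) ^ n := by
    rw [← Fintype.prod_sum (f := fun (_ : Fin n) (a : Option A) => if a ≠ none then t else 1)]
    simp [Fintype.sum_option]
  rw [← h1, ← nsmul_eq_mul]
  refine (Finset.card_nsmul_le_sum _ (fun w : Fin n → Option A =>
    ∏ i, (if w i ≠ none then t else 1)) _ fun w hw => ?_).trans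
    (Finset.sum_le_sum_of_subset_of_nonneg (Finset.subset_univ _) fun w _ _ =>
      Finset.prod_nonneg fun i _ => by split_ifs <;> positivity)
  rw [Finset.prod_ite, Finset.prod_const, Finset.prod_const_one, mul_one, ← Real.rpow_natCast]
  exact Real.rpow_le_rpow_of_exponent_ge ht ht1 (Finset.mem_filter.1 hw).2

theorem exists_card_patterns_le (A : Type*) [Fintype A] {κ : ℝ} (hκ : 0 < κ) :
    ∃ θ : ℝ, 0 < θ ∧ ∀ n : ℕ, ((Finset.univ.filter fun w : Fin n → Option A =>
      ((Finset.univ.filter fun i => w i ≠ none).card : ℝ) ≤ θ * n).card : ℝ) ≤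
      Real.exp (κ * n) := by
  obtain ⟨R, hR⟩ : ∃ R : ℝ, R = (Fintype.card A : ℝ) := ⟨_, rfl⟩
  have hR0 : 0 ≤ R := hR ▸ Nat.cast_nonneg _
  -- With `t = exp (-L)` and `exp L ≥ 2 (R + 1) / κ`, one gets `R t ≤ κ / 2`, hence `(1 + R t) ^ n ≤
  -- exp (κ n / 2)`.
  set t : ℝ := Real.exp (-(1 + 2 * (R + 1) / κ)) with htdef
  have ht : 0 < t := Real.exp_pos _
  have ht1 : t ≤ 1 := Real.exp_le_one_iff.2 (by have : 0 ≤ 2 * (R + 1) / κ := by positivity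
                                                linarith)
  have hRt : R * t ≤ κ / 2 := by
    have h1 : 2 * (R + 1) / κ ≤ Real.exp (1 + 2 * (R + 1) / κ) := by
      linarith [Real.add_one_le_exp (1 + 2 * (R + 1) / κ)]
    have h2 : t * (2 * (R + 1) / κ) ≤ 1 := by
      calc t * (2 * (R + 1) / κ) ≤ t * Real.exp (1 + 2 * (R + 1) / κ) := by gcongr
        _ = 1 := by rw [htdef, ← Real.exp_add]; simp
    have h3 : t * (2 * (R + 1)) ≤ κ := by
      rw [← mul_div_assoc, div_le_one hκ] at h2
      exact h2
    nlinarith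
  set L : ℝ := 1 + 2 * (R + 1) / κ with hL
  have hL0 : 0 < L := by positivity
  -- This `θ` makes `t ^ (θ n) = exp (-κ n / 2)`; dividing by it uses the other half of `κ`.
  refine ⟨κ / 2 / L, by positivity, fun n => ?_⟩
  have h := card_patterns_mul_pow_le (A := A) (n := n) (m := κ / 2 / L * n) ht ht1
  rw [← hR] at h
  have hpow : t ^ (κ / 2 / L * n : ℝ) = Real.exp (-(κ / 2 * n)) := by
    rw [htdef, ← Real.exp_mul]
    congr 1
    field_simp
  have hle : (1 + R * t) ^ n ≤ Real.exp (κ / 2 * n) := by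
    rw [mul_comm (κ / 2), Real.exp_nat_mul]
    refine pow_le_pow_left₀ (by positivity) ?_ n
    linarith [Real.add_one_le_exp (κ / 2)]
  rw [hpow, Real.exp_neg] at h
  have h' := (mul_inv_le_iff₀ (Real.exp_pos _)).1 (h.trans hle)
  rw [← Real.exp_add] at h'
  refine h'.trans (le_of_eq ?_)
  congr 1
  ring

/-- The colour of a point is the centre of a ball containing it, from a finite cover by `ρ`-balls of
radius `ε / 2`. -/
theorem IsContinuous.exists_coloring {X : Type u} [TopologicalSpace X] [CompactSpace X]
    {ρ : PseudoMetric X ℝ} (hρ : IsContinuous ρ) {ε : ℝ} (hε : 0 < ε) :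
    ∃ (s : Finset X) (c : X → s), ∀ x y, c x = c y → ρ x y ≤ ε := by
  obtain ⟨s, -, hs⟩ := isCompact_univ.elim_nhds_subcover (fun x : X => {y | ρ x y < ε / 2})
    fun x _ => (isOpen_lt (hρ.comp (Continuous.prodMk_right x)) continuous_const).mem_nhds (by
      change ρ x x < ε / 2
      rw [PseudoMetric.refl]
      positivity)
  have h : ∀ x : X, ∃ a : s, ρ a x < ε / 2 := fun x => by
    obtain ⟨a, ha, hax⟩ := mem_iUnion₂.1 (hs (mem_univ x))
    exact ⟨⟨a, ha⟩, hax⟩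
  choose c hc using h
  refine ⟨s, c, fun x y hxy => ?_⟩
  have h1 := hc x
  have h2 := hc y
  rw [← hxy] at h2
  have h3 := PseudoMetric.triangle ρ x (c x) y
  rw [PseudoMetric.symm ρ x (c x)] at h3
  linarith

theorem exists_sepNumber_infty_le {X : Type u} [TopologicalSpace X] [CompactSpace X]
    {ρ : PseudoMetric X ℝ} (hρ : IsContinuous ρ) {ε κ : ℝ} (hε : 0 < ε) (hκ : 0 < κ) :
    ∃ ε' : ℝ, 0 < ε' ∧ ∀ (n : ℕ) (S : Set (Fin n → X)),
      (sepNumber (fun x y : Fin n → X =>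
        tupleDist ρ .infty (fun i => some (x i)) (fun i => some (y i))) ε S : ℝ≥0∞) ≤
      ENNReal.ofReal (Real.exp (κ * n)) * (sepNumber (fun x y : Fin n → X =>
        tupleDist ρ .two (fun i => some (x i)) (fun i => some (y i))) ε' S : ℝ≥0∞) := by
  classical
  obtain ⟨s, c, hc⟩ := hρ.exists_coloring hε
  obtain ⟨θ, hθ, hcount⟩ := exists_card_patterns_le s hκ
  -- Chebyshev at level `ε / 2` then gives at most `θ n` bad coordinates.
  refine ⟨Real.sqrt θ * (ε / 2), by positivity, fun n S => ?_⟩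
  obtain ⟨D, hDS, hD, hnear⟩ := exists_maximal_separated (fun x y : Fin n → X =>
    tupleDist ρ .two (fun i => some (x i)) (fun i => some (y i)))
    (fun x y => by simp only [tupleDist, extDist_comm])
    (fun x => by simp [tupleDist, extDist_self]) (ε := Real.sqrt θ * (ε / 2))
    (by positivity) S
  choose! y hyD hy using hnear
  have key := sepNumber_le_card_mul (A := Fin n → Option s) (ε := ε) (X := S)
    (r := fun x y : Fin n → X =>
      tupleDist ρ .infty (fun i => some (x i)) (fun i => some (y i))) D
    (fun w => ((Finset.univ.filter fun i => w i ≠ none).card : ℝ) ≤ θ * n)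
    (fun x => (fun i => if ε / 2 ≤ ρ (x i) (y x i) then some (c (x i)) else none, y x))
    (fun x hx => ⟨by
      have h := card_le_of_tupleDist_two_le (half_pos hε) (hy x hx)
      rw [mul_div_assoc, div_self (half_pos hε).ne', mul_one, Real.sq_sqrt hθ.le] at h
      refine le_trans (le_of_eq ?_) h
      congr 2
      ext i
      simp only [ne_eq, ite_eq_right_iff, reduceCtorEq, imp_false, not_not, Finset.mem_filter,
        Finset.mem_univ, true_and]
      rfl, hyD x hx⟩)
    (fun x hx x' hx' h => by
      obtain ⟨h1, h2⟩ := Prod.mk.inj h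
      refine Real.iSup_le (fun i => ?_) hε.le
      have h3 := congrFun h1 i
      change ρ (x i) (x' i) ≤ ε
      rw [h2] at h3
      -- Equal codes force equal badness at `i`: either both entries are bad and share a colour, or
      -- both are within `ε / 2` of the same net point.
      by_cases hi : ε / 2 ≤ ρ (x i) (y x' i) <;> by_cases hi' : ε / 2 ≤ ρ (x' i) (y x' i)
      · simp only [hi, hi', if_true, Option.some.injEq] at h3
        exact hc _ _ h3
      · simp [hi, hi'] at h3
      · simp [hi, hi'] at h3
      · have h4 := PseudoMetric.triangle ρ (x i) (y x' i) (x' i)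
        rw [PseudoMetric.symm ρ (y x' i)] at h4
        linarith)
  have key' := ENat.toENNReal_mono (key.trans (mul_le_mul_right hD _))
  rw [ENat.toENNReal_mul] at key'
  refine key'.trans (mul_le_mul_left ?_ _)
  rw [ENat.toENNReal_coe, ← ENNReal.ofReal_natCast]
  refine ENNReal.ofReal_le_ofReal (le_trans (le_of_eq ?_) (hcount n))
  congr 2

theorem one_le_ofReal_exp {κ : ℝ} (hκ : 0 < κ) (n : ℕ) :
    1 ≤ ENNReal.ofReal (Real.exp (κ * n)) :=
  ENNReal.one_le_ofReal.2 (Real.one_le_exp (by positivity))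

section
variable {G : Type u} {H : Type v} [Grpd G]
    [TopologicalSpace H] [MeasurableSpace H] [Grpd H] {ν : Measure (Obj H)}
    {J : Type*} [Preorder J] [IsDirectedOrder J] [Nonempty J] {d : J → ℕ}
    {P : ∀ j, Measure (SoficMap H (d j))} {π : G → H}

theorem entropy_two_le_infty (hd : Tendsto d atTop atTop) (β : Bias J) (p : ℝ≥0∞)
    (hπ : IsMorphism π) (ρ : PseudoMetric (Obj G) ℝ) :
    entropy ν d P β p hπ ρ .two ≤ entropy ν d P β p hπ ρ .infty := by
  refine entropy_le_entropy hd β p hπ fun ε hε κ hκ => ⟨ε, hε, fun δ hδ F hF K =>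
    ⟨δ, hδ, F, hF, K, Eventually.of_forall fun j _ => ae_of_all _ fun σ => ?_⟩⟩
  refine le_trans ?_ (le_mul_of_one_le_left zero_le (one_le_ofReal_exp hκ _))
  exact ENat.toENNReal_mono (sepNumber_le_sepNumber subset_rfl fun x _ y _ h =>
    h.trans_le (tupleDist_two_le_infty _ _))

theorem entropy_infty_le_two [TopologicalSpace G] [CompactSpace (Obj G)]
    (hd : Tendsto d atTop atTop) (β : Bias J) (p : ℝ≥0∞)
    (hπ : IsMorphism π) {ρ : PseudoMetric (Obj G) ℝ} (hρ : IsContinuous ρ) :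
    entropy ν d P β p hπ ρ .infty ≤ entropy ν d P β p hπ ρ .two := by
  refine entropy_le_entropy hd β p hπ fun ε hε κ hκ => ?_
  obtain ⟨ε', hε', h⟩ := exists_sepNumber_infty_le hρ hε hκ
  exact ⟨ε', hε', fun δ hδ F hF K => ⟨δ, hδ, F, hF, K,
    Eventually.of_forall fun j _ => ae_of_all _ fun σ => h _ _⟩⟩

theorem entropy_eq_entropy_two [TopologicalSpace G] [CompactSpace (Obj G)]
    (hd : Tendsto d atTop atTop) (β : Bias J) (p : ℝ≥0∞)
    (hπ : IsMorphism π) {ρ : PseudoMetric (Obj G) ℝ} (hρ : IsContinuous ρ) (q : TupleDist) :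
    entropy ν d P β p hπ ρ q = entropy ν d P β p hπ ρ .two := by
  cases q
  · rfl
  · exact le_antisymm (entropy_infty_le_two hd β p hπ hρ) (entropy_two_le_infty hd β p hπ ρ)

end

/-! ### Translation by full bisections -/

section Translation

variable {H : Type u} [Grpd H]

theorem Grpd.comp_congr {a a' b b' : H} (ha : a = a') (hb : b = b')
    (h : Grpd.src a = Grpd.rng b) (h' : Grpd.src a' = Grpd.rng b') :
    Grpd.comp a b h = Grpd.comp a' b' h' := by
  subst ha hb
  rfl

theorem Grpd.unit_comp_of_eq {a c : H} (e : a = (Grpd.rng c : H)) (h : Grpd.src a = Grpd.rng c) :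
    Grpd.comp a c h = c :=
  (Grpd.comp_congr e rfl h (Grpd.src_unit _)).trans (Grpd.unit_comp c)

theorem Grpd.inv_comp_cancel (a c : H) (h : Grpd.src a = Grpd.rng c)
    (h' : Grpd.src (Grpd.inv a) = Grpd.rng (Grpd.comp a c h)) :
    Grpd.comp (Grpd.inv a) (Grpd.comp a c h) h' = c := by
  rw [← Grpd.comp_assoc (Grpd.inv a) a c (Grpd.src_inv a) h]
  exact Grpd.unit_comp_of_eq ((Grpd.inv_comp a).trans (by rw [h])) _

theorem Grpd.comp_inv_cancel (a c : H) (h : Grpd.src (Grpd.inv a) = Grpd.rng c)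
    (h' : Grpd.src a = Grpd.rng (Grpd.comp (Grpd.inv a) c h)) :
    Grpd.comp a (Grpd.comp (Grpd.inv a) c h) h' = c := by
  rw [← Grpd.comp_assoc a (Grpd.inv a) c (Grpd.rng_inv a).symm h]
  exact Grpd.unit_comp_of_eq ((Grpd.comp_inv a).trans (by rw [← Grpd.src_inv, h])) _

variable [TopologicalSpace H]

theorem IsBisection.src_injOn {U : Set H} (hU : IsBisection U) : InjOn (Grpd.src (H := H)) U :=
  injOn_iff_injective.2 hU.src_embedding.injective

theorem IsBisection.rng_injOn {U : Set H} (hU : IsBisection U) : InjOn (Grpd.rng (H := H)) U :=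
  injOn_iff_injective.2 hU.rng_embedding.injective

theorem exists_continuous_section {X Y : Type*} [TopologicalSpace X] [TopologicalSpace Y]
    {f : X → Y} {U : Set X} (hf : IsOpenEmbedding fun h : U => f h) (hU : f '' U = univ) :
    ∃ u : Y → X, Continuous u ∧ ∀ y, u y ∈ U ∧ f (u y) = y := by
  have hsurj : Function.Surjective fun h : U => f h := fun y => by
    obtain ⟨x, hx, rfl⟩ := hU.symm ▸ mem_univ y
    exact ⟨⟨x, hx⟩, rfl⟩
  let e := (Equiv.ofBijective _ ⟨hf.injective, hsurj⟩).toHomeomorphOfContinuousOpen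
    hf.continuous hf.isOpenMap
  exact ⟨fun y => e.symm y, continuous_subtype_val.comp e.symm.continuous, fun y =>
    ⟨(e.symm y).2, e.apply_symm_apply y⟩⟩

/-- The homeomorphisms of the arrow space and of the unit space that a full bisection induces
by multiplication from the left. -/
theorem IsFullBisection.exists_translation [TopologicalGrpd H] {U : Set H}
    (hU : IsFullBisection U) :
    ∃ (Φ : H ≃ₜ H) (φ : Obj H ≃ₜ Obj H), (∀ h, Grpd.src (Φ h) = Grpd.src h) ∧
      (∀ h, Grpd.rng (Φ h) = φ (Grpd.rng h)) ∧ (∀ A : Set H, setComp U A = Φ '' A) ∧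
      ∀ a ∈ U, φ (Grpd.src a) = Grpd.rng a := by
  obtain ⟨hB, hs, hr⟩ := hU
  obtain ⟨u, hu, huU⟩ := exists_continuous_section hB.src_embedding hs
  obtain ⟨v, hv, hvU⟩ := exists_continuous_section hB.rng_embedding hr
  have huv : ∀ x, v (Grpd.rng (u x)) = u x := fun x =>
    hB.rng_injOn (hvU _).1 (huU x).1 (hvU _).2
  have hvu : ∀ x, u (Grpd.src (v x)) = v x := fun x =>
    hB.src_injOn (huU _).1 (hvU x).1 (huU _).2
  have hua : ∀ a ∈ U, u (Grpd.src a) = a := fun a ha => hB.src_injOn (huU _).1 ha (huU _).2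
  have hcs := TopologicalGrpd.continuous_src (H := H)
  have hcr := TopologicalGrpd.continuous_rng (H := H)
  have h1 : ∀ h : H, Grpd.src (u (Grpd.rng h)) = Grpd.rng h := fun h => (huU _).2
  have h2 : ∀ h : H, Grpd.src (Grpd.inv (v (Grpd.rng h))) = Grpd.rng h := fun h => by
    rw [Grpd.src_inv, (hvU _).2]
  -- An arrow `h` is multiplied by the arrow `u (r h)` of `U` starting where `h` ends; the inverse
  -- map uses the arrow `v (r h)` of `U` ending there.
  let Φ : H ≃ₜ H :=
    { toFun := fun h => Grpd.comp (u (Grpd.rng h)) h (h1 h)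
      invFun := fun h => Grpd.comp (Grpd.inv (v (Grpd.rng h))) h (h2 h)
      left_inv := fun h => by
        have e : v (Grpd.rng (Grpd.comp (u (Grpd.rng h)) h (h1 h))) = u (Grpd.rng h) := by
          rw [Grpd.rng_comp, huv]
        refine (Grpd.comp_congr (congrArg Grpd.inv e) rfl _ ?_).trans
          (Grpd.inv_comp_cancel (u (Grpd.rng h)) h (h1 h) ?_)
        all_goals rw [Grpd.src_inv, Grpd.rng_comp]
      right_inv := fun h => by
        have e : u (Grpd.rng (Grpd.comp (Grpd.inv (v (Grpd.rng h))) h (h2 h))) =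
            v (Grpd.rng h) := by
          rw [Grpd.rng_comp, Grpd.rng_inv, hvu]
        refine (Grpd.comp_congr e rfl _ ?_).trans
          (Grpd.comp_inv_cancel (v (Grpd.rng h)) h (h2 h) ?_)
        all_goals rw [Grpd.rng_comp, Grpd.rng_inv]
      continuous_toFun := TopologicalGrpd.continuous_comp.comp
        (Continuous.subtype_mk ((hu.comp hcr).prodMk continuous_id) h1)
      continuous_invFun := TopologicalGrpd.continuous_comp.comp
        (Continuous.subtype_mk
          (((TopologicalGrpd.continuous_inv.comp hv).comp hcr).prodMk continuous_id) h2) }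
  let φ : Obj H ≃ₜ Obj H :=
    { toFun := fun x => Grpd.rng (u x)
      invFun := fun x => Grpd.src (v x)
      left_inv := fun x => by
        change Grpd.src (v (Grpd.rng (u x))) = x
        rw [huv, (huU x).2]
      right_inv := fun x => by
        change Grpd.rng (u (Grpd.src (v x))) = x
        rw [hvu, (hvU x).2]
      continuous_toFun := hcr.comp hu
      continuous_invFun := hcs.comp hv }
  refine ⟨Φ, φ, fun h => Grpd.src_comp _ _ _, fun h => Grpd.rng_comp _ _ _, fun A => ?_,
    fun a ha => congrArg Grpd.rng (hua a ha)⟩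
  ext h
  constructor
  · rintro ⟨a, ha, b, hb, hab, rfl⟩
    exact ⟨b, hb, Grpd.comp_congr (by rw [← hab, hua a ha]) rfl _ _⟩
  · rintro ⟨b, hb, rfl⟩
    exact ⟨u (Grpd.rng b), (huU _).1, b, hb, h1 b, rfl⟩

theorem IsBisection.image_translation {V : Set H} (hV : IsBisection V) {Φ : H ≃ₜ H}
    {φ : Obj H ≃ₜ Obj H} (hs : ∀ h, Grpd.src (Φ h) = Grpd.src h)
    (hr : ∀ h, Grpd.rng (Φ h) = φ (Grpd.rng h)) : IsBisection (Φ '' V) := by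
  refine ⟨Φ.isOpenMap _ hV.isOpen, ?_, ?_⟩
  · convert hV.src_embedding.comp (Φ.image V).symm.isOpenEmbedding using 1
    ext ⟨_, h, hh, rfl⟩
    have e : (Φ.image V).symm ⟨Φ h, h, hh, rfl⟩ = ⟨h, hh⟩ :=
      (Φ.image V).symm_apply_eq.2 rfl
    simp only [Function.comp_apply, e, hs]
  · convert φ.isOpenEmbedding.comp
      (hV.rng_embedding.comp (Φ.image V).symm.isOpenEmbedding) using 1
    ext ⟨_, h, hh, rfl⟩
    have e : (Φ.image V).symm ⟨Φ h, h, hh, rfl⟩ = ⟨h, hh⟩ :=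
      (Φ.image V).symm_apply_eq.2 rfl
    simp only [Function.comp_apply, e, hr]

/-- A full bisection is the image of the compact unit space under a continuous section of the source
map. Closedness is what lets it serve as its own neighbourhood in the definition of `[[H]]_top`. -/
theorem IsFullBisection.isClosed [T2Space H] [CompactSpace (Obj H)] {U : Set H}
    (hU : IsFullBisection U) : IsClosed U := by
  obtain ⟨u, hu, huU⟩ := exists_continuous_section hU.1.src_embedding hU.2.1
  have : U = range u := by
    refine Subset.antisymm (fun a ha => ⟨Grpd.src a, ?_⟩) ?_
    · exact hU.1.src_injOn (huU _).1 ha (huU _).2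
    · rintro _ ⟨x, rfl⟩
      exact (huU x).1
  rw [this]
  exact (isCompact_range hu).isClosed

variable [MeasurableSpace H]

theorem IsFullBisection.isTop [T2Space H] [CompactSpace (Obj H)] {U : PartialAut H}
    (hU : IsFullBisection U.1) (ν : Measure (Obj H)) : IsTop ν U := by
  refine ⟨1, fun _ => U.1, (iUnion_const _).symm, fun _ => ⟨U.1, hU.1, ?_, ?_, ?_⟩,
    fun _ => ?_, fun _ => ?_, Subsingleton.pairwise, Subsingleton.pairwise⟩
  · exact hU.isClosed.closure_subset
  · rw [hU.2.1]; exact subset_univ _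
  · rw [hU.2.2]; exact subset_univ _
  · rw [hU.2.1]; simp [NullBoundary]
  · rw [hU.2.2]; simp [NullBoundary]

variable [BorelSpace H]

theorem IsBisection.isPartialAut {U : Set H} (hU : IsBisection U) : IsPartialAut U :=
  ⟨hU.isOpen.measurableSet, hU.src_embedding.measurableEmbedding,
    hU.rng_embedding.measurableEmbedding⟩

/-- The homeomorphism of the unit space induced by a full bisection preserves null sets. -/
theorem IsPMP.measure_image_eq_zero [MeasurableGrpd H] {ν : Measure (Obj H)} (hν : IsPMP H ν)
    {U : Set H} (hU : IsFullBisection U) {φ : Obj H ≃ₜ Obj H}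
    (hφ : ∀ a ∈ U, φ (Grpd.src a) = Grpd.rng a) {A : Set (Obj H)} (hA : MeasurableSet A)
    (h0 : ν A = 0) : ν (φ '' A) = 0 := by
  -- The arrows of `U` starting in `A` have source mass zero, while every point of `φ '' A` is the
  -- range of one of them, so their range mass is at least `ν (φ '' A)`.
  set B : Set H := U ∩ Grpd.src ⁻¹' A with hB
  have hBm : MeasurableSet B :=
    hU.1.isOpen.measurableSet.inter (MeasurableGrpd.measurable_src hA)
  have hsrc : srcMass ν B = 0 := by
    refine (lintegral_congr_ae (g := fun _ => 0) ?_).trans lintegral_zero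
    have hae : ∀ᵐ x ∂ν, x ∉ A := measure_eq_zero_iff_ae_notMem.1 h0
    filter_upwards [hae] with x hx
    have : {h : H | Grpd.src h = x} ∩ B = ∅ := by
      refine eq_empty_of_forall_notMem fun h hh => hx ?_
      have h1 : Grpd.src h = x := hh.1
      exact h1 ▸ hh.2.2
    simp [this]
  have hφA : MeasurableSet (φ '' A) := φ.toMeasurableEquiv.measurableSet_image.2 hA
  have hrng : ν (φ '' A) ≤ rngMass ν B := by
    rw [← lintegral_indicator_one hφA]
    refine lintegral_mono fun x => ?_
    by_cases hx : x ∈ φ '' A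
    · rw [indicator_of_mem hx]
      obtain ⟨y, hy, rfl⟩ := hx
      obtain ⟨a, ha, rfl⟩ := hU.2.1.symm ▸ mem_univ y
      have h1 : 1 ≤ ({h : H | Grpd.rng h = φ (Grpd.src a)} ∩ B).encard :=
        one_le_encard_iff_nonempty.2 ⟨a, (hφ a ha).symm, ha, hy⟩
      simpa using ENat.toENNReal_mono h1
    · rw [indicator_of_notMem hx]
      exact zero_le
  rw [← hν.invariant B hBm, hsrc] at hrng
  exact le_antisymm hrng zero_le

/-- The product of a full bisection and an element of `[[H]]_top` belongs to `[[H]]_top`. -/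
theorem IsTop.full_mul [TopologicalGrpd H] [MeasurableGrpd H] {ν : Measure (Obj H)}
    (hν : IsPMP H ν) {U f : PartialAut H} (hU : IsFullBisection U.1) (hf : IsTop ν f) :
    IsTop ν (U * f) := by
  obtain ⟨Φ, φ, hs, hr, hUA, hφ⟩ := hU.exists_translation
  obtain ⟨n, g, hfg, hbis, hsn, hrn, hsd, hrd⟩ := hf
  have hsim : ∀ A : Set H, Grpd.src '' (Φ '' A) = Grpd.src '' A := fun A => by
    rw [image_image]
    exact image_congr fun h _ => hs h
  have hrim : ∀ A : Set H, Grpd.rng '' (Φ '' A) = φ '' (Grpd.rng '' A) := fun A => by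
    rw [image_image, image_image]
    exact image_congr fun h _ => hr h
  -- Translation fixes sources and moves ranges by `φ`, so the decomposition is carried along;
  -- invariance of `ν` is needed only for the boundaries of the ranges.
  refine ⟨n, fun i => Φ '' g i, ?_, fun i => ?_, fun i => ?_, fun i => ?_, ?_, ?_⟩
  · change setComp U.1 f.1 = _
    rw [hUA, hfg, image_iUnion]
  · obtain ⟨V, hV, h1, h2, h3⟩ := hbis i
    refine ⟨Φ '' V, hV.image_translation hs hr, ?_, ?_, ?_⟩
    · rw [← Φ.image_closure]
      exact image_mono h1
    · rwa [hsim, hsim]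
    · rw [hrim, hrim, ← φ.image_closure]
      exact image_mono h3
  · rw [hsim]
    exact hsn i
  · rw [hrim]
    refine ⟨φ.toMeasurableEquiv.measurableSet_image.2 (hrn i).1, ?_⟩
    rw [← φ.image_frontier]
    exact hν.measure_image_eq_zero hU hφ isClosed_frontier.measurableSet (hrn i).2
  · intro i j hij
    simpa only [hsim] using hsd hij
  · intro i j hij
    simpa only [hrim, disjoint_image_iff φ.injective] using hrd hij

end Translation

/-! ### The partial action of `[[H]]` on `G⁰` -/

section Action

variable {G : Type u} {H : Type v} [Grpd G] [Grpd H] {π : G → H}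

theorem IsClassBijectiveFactor.src_map (hπ : IsClassBijectiveFactor π) (g : G) :
    Grpd.src (π g) = hπ.onObj (Grpd.src g) :=
  (hπ.src_bij (Grpd.src g)).mapsTo rfl

theorem IsClassBijectiveFactor.rng_map (hπ : IsClassBijectiveFactor π) (g : G) :
    Grpd.rng (π g) = hπ.onObj (Grpd.rng g) :=
  (hπ.rng_bij (Grpd.rng g)).mapsTo rfl

theorem IsClassBijectiveFactor.src_injOn_preimage (hπ : IsClassBijectiveFactor π) {f : Set H}
    (hf : InjOn (Grpd.src (H := H)) f) : InjOn (Grpd.src (H := G)) (π ⁻¹' f) := by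
  intro g hg g' hg' h
  refine (hπ.src_bij (Grpd.src g)).injOn rfl h.symm (hf hg hg' ?_)
  rw [hπ.src_map, hπ.src_map, h]

theorem act_src {f : Set G} (hf : InjOn (Grpd.src (H := G)) f) {g : G} (hg : g ∈ f) :
    act f (Grpd.src g) = some (Grpd.rng g) := by
  have h : ∃ g' ∈ f, Grpd.src g' = Grpd.src g := ⟨g, hg, rfl⟩
  rw [act, dif_pos h]
  rw [hf h.choose_spec.1 hg h.choose_spec.2]

theorem act_eq_none {f : Set G} {x : Obj G} (h : ¬ ∃ g ∈ f, Grpd.src g = x) : act f x = none :=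
  dif_neg h

theorem PartialAut.src_injOn [MeasurableSpace H] (f : PartialAut H) :
    InjOn (Grpd.src (H := H)) f.1 :=
  injOn_iff_injective.2 f.2.src_embedding.injective

/-- The lifted action is exactly multiplicative, also where undefined: bijectivity on source fibres
lifts any factorization in `H` of the image of an arrow at `x` to arrows of `G` starting at `x`. -/
theorem act_preimage_mul [MeasurableSpace H] [MeasurableGrpd H] (hπ : IsClassBijectiveFactor π)
    (s t : PartialAut H) (x : Obj G) :
    act (π ⁻¹' (s * t).1) x = (act (π ⁻¹' t.1) x).bind (act (π ⁻¹' s.1)) := by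
  have hs := hπ.src_injOn_preimage s.src_injOn
  have ht := hπ.src_injOn_preimage t.src_injOn
  have hst := hπ.src_injOn_preimage (s * t).src_injOn
  by_cases h1 : ∃ b ∈ π ⁻¹' t.1, Grpd.src b = x
  · obtain ⟨b, hb, rfl⟩ := h1
    rw [act_src ht hb, Option.bind_some]
    by_cases h2 : ∃ a ∈ π ⁻¹' s.1, Grpd.src a = Grpd.rng b
    · obtain ⟨a, ha, hab⟩ := h2
      obtain ⟨h', e⟩ := hπ.map_comp a b hab
      have hmem : Grpd.comp a b hab ∈ π ⁻¹' (s * t).1 := ⟨π a, ha, π b, hb, h', e.symm⟩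
      rw [← hab, act_src hs ha, ← Grpd.src_comp a b hab, act_src hst hmem, Grpd.rng_comp]
    · rw [act_eq_none h2]
      refine act_eq_none ?_
      rintro ⟨g, ⟨a', ha', b', hb', hab', e⟩, hg⟩
      have hb2 : b' = π b := t.src_injOn hb' hb (by
        rw [hπ.src_map b, ← hg, ← hπ.src_map g, ← e, Grpd.src_comp])
      obtain ⟨a, ha, rfl⟩ := (hπ.src_bij (Grpd.rng b)).surjOn (show a' ∈ _ by
        change Grpd.src a' = hπ.onObj (Grpd.rng b)
        rw [hab', hb2, hπ.rng_map])
      exact h2 ⟨a, ha', ha⟩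
  · rw [act_eq_none h1, Option.bind_none]
    refine act_eq_none ?_
    rintro ⟨g, ⟨a', ha', b', hb', hab', e⟩, hg⟩
    obtain ⟨b, hb, rfl⟩ := (hπ.src_bij x).surjOn (show b' ∈ _ by
      change Grpd.src b' = hπ.onObj x
      rw [← hg, ← hπ.src_map g, ← e, Grpd.src_comp])
    exact h1 ⟨b, hb', hb⟩

theorem IsEtale.isOpenMap_src [TopologicalSpace G] (hG : IsEtale G) :
    IsOpenMap (Grpd.src (H := G)) := by
  intro O hO
  have : Grpd.src '' O = ⋃ (V : Set G) (_ : IsBisection V),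
      (fun h : V => Grpd.src (h : G)) '' (Subtype.val ⁻¹' O) := by
    ext x
    simp only [mem_iUnion, mem_image, mem_preimage, Subtype.exists]
    constructor
    · rintro ⟨g, hg, rfl⟩
      obtain ⟨V, hV, hgV⟩ := hG g
      exact ⟨V, hV, g, hgV, hg, rfl⟩
    · rintro ⟨V, hV, g, hgV, hg, rfl⟩
      exact ⟨g, hg, rfl⟩
  rw [this]
  exact isOpen_iUnion fun V => isOpen_iUnion fun hV =>
    hV.src_embedding.isOpenMap _ (hO.preimage continuous_subtype_val)

/-- A full bisection acts on `G⁰` by a continuous map, if `G` is étale. -/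
theorem IsFullBisection.exists_continuous_act [TopologicalSpace G] [TopologicalGrpd G]
    [TopologicalSpace H] (hG : IsEtale G) (hπc : Continuous π) (hπ : IsClassBijectiveFactor π)
    {U : Set H} (hU : IsFullBisection U) :
    ∃ φ : Obj G → Obj G, Continuous φ ∧ ∀ x, act (π ⁻¹' U) x = some (φ x) := by
  have hinj := hπ.src_injOn_preimage hU.1.src_injOn
  have hex : ∀ x : Obj G, ∃ g ∈ π ⁻¹' U, Grpd.src g = x := fun x => by
    obtain ⟨a, ha, hax⟩ := hU.2.1.symm ▸ mem_univ (hπ.onObj x)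
    obtain ⟨g, hg, rfl⟩ := (hπ.src_bij x).surjOn hax
    exact ⟨g, ha, hg⟩
  choose g hgU hg using hex
  have hgc : Continuous g := by
    refine continuous_def.2 fun O hO => ?_
    -- Continuity of the lift `g` reduces to openness of the source map, as `π ⁻¹' U` is open and
    -- the source is injective on it.
    have : g ⁻¹' O = Grpd.src '' (O ∩ π ⁻¹' U) := by
      ext x
      constructor
      · exact fun hx => ⟨g x, ⟨hx, hgU x⟩, hg x⟩
      · rintro ⟨a, ⟨haO, haU⟩, rfl⟩
        have : g (Grpd.src a) = a := hinj (hgU _) haU (hg _)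
        rwa [mem_preimage, this]
    rw [this]
    exact hG.isOpenMap_src _ (hO.inter (hU.1.isOpen.preimage hπc))
  refine ⟨fun x => Grpd.rng (g x), TopologicalGrpd.continuous_rng.comp hgc, fun x => ?_⟩
  conv_lhs => rw [← hg x]
  exact act_src hinj (hgU x)

/-- A dynamically generating pseudo-metric controls, through finitely many full bisections,
every continuous pseudo-metric. -/
theorem IsDynGenerating.exists_finset [TopologicalSpace G] [TopologicalGrpd G]
    [CompactSpace (Obj G)] [TopologicalSpace H] [MeasurableSpace H] [BorelSpace H]
    (hG : IsEtale G) (hπc : Continuous π) (hπ : IsClassBijectiveFactor π)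
    {ρ ρ' : PseudoMetric (Obj G) ℝ} (hρ : IsContinuous ρ) (hρ' : IsContinuous ρ')
    (hgen : IsDynGenerating π ρ) {η : ℝ} (hη : 0 < η) :
    ∃ (S : Finset (PartialAut H)) (τ : ℝ), 0 < τ ∧ (∀ U ∈ S, IsFullBisection U.1) ∧
      ∀ x y : Obj G, (∀ U ∈ S, extDist ρ (act (π ⁻¹' U.1) x) (act (π ⁻¹' U.1) y) < τ) →
        ρ' x y < η := by
  classical
  -- The pairs to be excluded form a compact set off the diagonal, so finitely many `U` separate all
  -- of them.
  set C : Set (Obj G × Obj G) := {z | η ≤ ρ' z.1 z.2} with hC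
  have hCc : IsCompact C := (isClosed_le continuous_const hρ').isCompact
  let Φ : PartialAut H → Obj G × Obj G → ℝ := fun U z =>
    extDist ρ (act (π ⁻¹' U.1) z.1) (act (π ⁻¹' U.1) z.2)
  have hΦ : ∀ U : PartialAut H, IsFullBisection U.1 → Continuous (Φ U) := fun U hU => by
    obtain ⟨φ, hφ, e⟩ := hU.exists_continuous_act hG hπc hπ
    have : Φ U = fun z => ρ (φ z.1) (φ z.2) := by
      funext z
      change extDist ρ (act (π ⁻¹' U.1) z.1) (act (π ⁻¹' U.1) z.2) = _
      rw [e, e]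
      rfl
    rw [this]
    exact hρ.comp ((hφ.comp continuous_fst).prodMk (hφ.comp continuous_snd))
  have hpt : ∀ z ∈ C, ∃ U : PartialAut H, IsFullBisection U.1 ∧ 0 < Φ U z := fun z hz => by
    obtain ⟨U, hU, h⟩ := hgen z.1 z.2 (fun e => by
      have : η ≤ ρ' z.1 z.2 := hz
      rw [e, PseudoMetric.refl] at this
      linarith)
    exact ⟨⟨U, hU.1.isPartialAut⟩, hU, h⟩
  rcases C.eq_empty_or_nonempty with hCe | ⟨z₁, hz₁⟩
  · exact ⟨∅, 1, one_pos, by simp, fun x y _ => not_le.1 fun h =>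
      eq_empty_iff_forall_notMem.1 hCe (x, y) h⟩
  have : Nonempty (PartialAut H) := ⟨(hpt z₁ hz₁).choose⟩
  choose! u huF hu using hpt
  obtain ⟨s, hsC, hs⟩ := hCc.elim_nhds_subcover (fun z => {w | Φ (u z) z / 2 < Φ (u z) w})
    fun z hz => (isOpen_lt continuous_const (hΦ _ (huF z hz))).mem_nhds
      (half_lt_self (hu z hz))
  obtain ⟨τ, hτ, hτs⟩ : ∃ τ : ℝ, 0 < τ ∧ ∀ z ∈ s, τ ≤ Φ (u z) z / 2 := by
    rcases s.eq_empty_or_nonempty with rfl | hne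
    · exact ⟨1, one_pos, by simp⟩
    · obtain ⟨z₀, hz₀, hmin⟩ := s.exists_min_image (fun z => Φ (u z) z / 2) hne
      exact ⟨_, half_pos (hu z₀ (hsC z₀ hz₀)), hmin⟩
  refine ⟨s.image u, τ, hτ, fun U hU => ?_, fun x y hxy => ?_⟩
  · obtain ⟨z, hz, rfl⟩ := Finset.mem_image.1 hU
    exact huF z (hsC z hz)
  · by_contra! hcon
    obtain ⟨z, hz, hzw⟩ := mem_iUnion₂.1 (hs (show (x, y) ∈ C from hcon))
    have h1 : Φ (u z) (x, y) < τ := hxy (u z) (Finset.mem_image_of_mem u hz)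
    have h2 : Φ (u z) z / 2 < Φ (u z) (x, y) := hzw
    linarith [hτs z hz]

end Action

/-! ### Change of the pseudo-metric -/

section Counting

theorem card_biUnion_le_mul {ι : Type*} {n : ℕ} (S : Finset ι) (B : ι → Finset (Fin n))
    {θ : ℝ} (h : ∀ s ∈ S, ((B s).card : ℝ) ≤ θ * n) :
    ((S.biUnion B).card : ℝ) ≤ S.card * θ * n := by
  calc ((S.biUnion B).card : ℝ) ≤ ∑ s ∈ S, ((B s).card : ℝ) := by
        exact_mod_cast Finset.card_biUnion_le
    _ ≤ S.card • (θ * n) := Finset.sum_le_card_nsmul _ _ _ h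
    _ = S.card * θ * n := by rw [nsmul_eq_mul, mul_assoc]

theorem card_preimage_le {n : ℕ} (f : Fin n ≃. Fin n) (C : Finset (Fin n)) :
    (Finset.univ.filter fun i => ∃ j ∈ C, f i = some j).card ≤ C.card := by
  refine Finset.card_le_card_of_injOn (fun i => (f i).getD i) (fun i hi => ?_) ?_
  · obtain ⟨j, hj, e⟩ := (Finset.mem_filter.1 hi).2
    simpa [e] using hj
  · intro i hi i' hi' h
    obtain ⟨j, -, e⟩ := (Finset.mem_filter.1 hi).2
    obtain ⟨j', -, e'⟩ := (Finset.mem_filter.1 hi').2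
    have hjj : j = j' := by simpa [e, e'] using h
    subst hjj
    exact f.inj (Option.mem_def.2 e) (Option.mem_def.2 e')

/-- Where `f i ≠ g i`, the edge at `i` of `f`, or that of `g` if `f i` is undefined, lies in exactly
one graph. The innermost default of `getD` is never reached. -/
theorem card_ne_le_ncard {n : ℕ} (f g : Fin n ≃. Fin n) :
    (Finset.univ.filter fun i => f i ≠ g i).card ≤ (symmDiff (graph f) (graph g)).ncard := by
  rw [← ncard_coe_finset]
  refine ncard_le_ncard_of_injOn (fun i => ((f i).getD ((g i).getD i), i)) (fun i hi => ?_)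
    (fun i _ i' _ h => congrArg Prod.snd h) (toFinite _)
  have hne : f i ≠ g i := by simpa using hi
  rcases hf : f i with _ | j
  · rcases hg : g i with _ | k
    · exact absurd (hf.trans hg.symm) hne
    · refine Or.inr ⟨?_, ?_⟩ <;> simp [graph, hf, hg]
  · refine Or.inl ⟨?_, fun h => hne ?_⟩
    · simp [graph, hf]
    · have h' : g i = some j := by simpa [graph, hf] using h
      rw [hf, h']

theorem exists_pos_le_of_continuous {c : ℝ → ℝ} (hc : Continuous c) (h0 : c 0 = 0) {θ : ℝ}
    (hθ : 0 < θ) : ∃ r : ℝ, 0 < r ∧ c r ≤ θ := by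
  have h1 : ∀ᶠ r in 𝓝[>] (0 : ℝ), c r < θ :=
    (hc.continuousAt.eventually_lt continuousAt_const (h0.trans_lt hθ)).filter_mono
      nhdsWithin_le_nhds
  obtain ⟨r, hr, hr0⟩ := (h1.and self_mem_nhdsWithin).exists
  exact ⟨r, hr0, hr.le⟩

theorem exists_sqrt_lt (M : ℝ) {ε : ℝ} (hε : 0 < ε) :
    ∃ η : ℝ, 0 < η ∧ ∃ θ : ℝ, 0 < θ ∧ ∀ θ' ≤ θ, Real.sqrt (η ^ 2 + M ^ 2 * θ') < ε := by
  -- The two terms under the root are at most `ε ^ 2 / 4` and `ε ^ 2 / 2`; the `+ 1` covers `M = 0`.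
  refine ⟨ε / 2, half_pos hε, ε ^ 2 / 2 / (M ^ 2 + 1), by positivity, fun θ' hθ' => ?_⟩
  rw [Real.sqrt_lt' hε]
  have h1 : M ^ 2 * θ' ≤ ε ^ 2 / 2 := by
    calc M ^ 2 * θ' ≤ M ^ 2 * (ε ^ 2 / 2 / (M ^ 2 + 1)) := by gcongr
      _ ≤ (M ^ 2 + 1) * (ε ^ 2 / 2 / (M ^ 2 + 1)) := by gcongr; linarith
      _ = ε ^ 2 / 2 := by field_simp
  nlinarith [sq_pos_of_pos hε]

end Counting

/-! ### Transfer of closeness and of approximate orbits from `ρ` to `ρ'`. -/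

section ChangeOfMetric

variable {G : Type u} {H : Type v} [Grpd G] [Grpd H] [MeasurableSpace H] {π : G → H}
  {ρ ρ' : PseudoMetric (Obj G) ℝ}

/-- If two approximate partial orbits are close with respect to `ρ`, then they are close with
respect to `ρ'`. -/
theorem tupleDist_two_le_of_close
    (hb : BddAbove (range fun p : Obj G × Obj G => ρ p.1 p.2))
    (hb' : BddAbove (range fun p : Obj G × Obj G => ρ' p.1 p.2))
    {S : Finset (PartialAut H)} {τ η : ℝ} (hτ : 0 < τ)
    (hS : ∀ x y : Obj G, (∀ U ∈ S, extDist ρ (act (π ⁻¹' U.1) x) (act (π ⁻¹' U.1) y) < τ) →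
      ρ' x y < η)
    {n : ℕ} {σ : SoficMap H n} {x y : Fin n → Obj G} {r : ℝ}
    (hx : ∀ U ∈ S, tupleDist ρ .two (fun i => act (π ⁻¹' U.1) (x i))
      (fun i => (σ U i).map x) ≤ r)
    (hy : ∀ U ∈ S, tupleDist ρ .two (fun i => act (π ⁻¹' U.1) (y i))
      (fun i => (σ U i).map y) ≤ r)
    (hxy : tupleDist ρ .two (fun i => some (x i)) (fun i => some (y i)) ≤ r) :
    tupleDist ρ' .two (fun i => some (x i)) (fun i => some (y i)) ≤
      Real.sqrt (η ^ 2 + pdiam ρ' ^ 2 * (S.card * (3 * (r / (τ / 3)) ^ 2))) := by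
  classical
  have hτ3 : 0 < τ / 3 := by positivity
  set D : Finset (Fin n) := {i | τ / 3 ≤ extDist ρ (some (x i)) (some (y i))} with hD
  -- Bad coordinates for `U`: `x` fails to follow `U`, `y` fails to, or `σ U` leads to a coordinate
  -- where `x` and `y` are far apart. Elsewhere three steps of length below `τ / 3` join `U·x_i` to
  -- `U·y_i`.
  let B₁ : PartialAut H → Finset (Fin n) := fun U =>
    {i | τ / 3 ≤ extDist ρ (act (π ⁻¹' U.1) (x i)) ((σ U i).map x)}
  let B₂ : PartialAut H → Finset (Fin n) := fun U =>
    {i | τ / 3 ≤ extDist ρ (act (π ⁻¹' U.1) (y i)) ((σ U i).map y)}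
  let B₃ : PartialAut H → Finset (Fin n) := fun U => {i | ∃ j ∈ D, σ U i = some j}
  have hcard : ∀ U ∈ S, ((B₁ U ∪ B₂ U ∪ B₃ U).card : ℝ) ≤ 3 * (r / (τ / 3)) ^ 2 * n := by
    intro U hU
    have h1 : ((B₁ U).card : ℝ) ≤ _ := card_le_of_tupleDist_two_le hτ3 (hx U hU)
    have h2 : ((B₂ U).card : ℝ) ≤ _ := card_le_of_tupleDist_two_le hτ3 (hy U hU)
    have h3 : ((B₃ U).card : ℝ) ≤ D.card := by exact_mod_cast card_preimage_le (σ U) D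
    have h4 : (D.card : ℝ) ≤ _ := card_le_of_tupleDist_two_le hτ3 hxy
    have h5 : ((B₁ U ∪ B₂ U ∪ B₃ U).card : ℝ) ≤ (B₁ U).card + (B₂ U).card + (B₃ U).card := by
      exact_mod_cast (Finset.card_union_le _ _).trans
        (Nat.add_le_add_right (Finset.card_union_le _ _) _)
    linarith
  refine tupleDist_two_le hb' (by positivity) (card_biUnion_le_mul S _ hcard) fun i hi => ?_
  refine (hS _ _ fun U hU => ?_).le
  have hi' : i ∉ B₁ U ∪ B₂ U ∪ B₃ U := fun h => hi (Finset.mem_biUnion.2 ⟨U, hU, h⟩)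
  simp only [Finset.mem_union, not_or] at hi'
  obtain ⟨⟨h1, h2⟩, h3⟩ := hi'
  have h1' : extDist ρ (act (π ⁻¹' U.1) (x i)) ((σ U i).map x) < τ / 3 := by simpa [B₁] using h1
  have h2' : extDist ρ (act (π ⁻¹' U.1) (y i)) ((σ U i).map y) < τ / 3 := by simpa [B₂] using h2
  have h3' : extDist ρ ((σ U i).map x) ((σ U i).map y) < τ / 3 := by
    rcases e : σ U i with _ | j
    · exact (extDist_self (ρ := ρ) _).trans_lt hτ3
    · by_contra! hcon
      exact h3 (Finset.mem_filter.2 ⟨Finset.mem_univ _, j,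
        Finset.mem_filter.2 ⟨Finset.mem_univ _, hcon⟩, e⟩)
  rw [extDist_comm] at h2'
  have t1 := extDist_triangle hb (act (π ⁻¹' U.1) (x i)) ((σ U i).map x) (act (π ⁻¹' U.1) (y i))
  have t2 := extDist_triangle hb ((σ U i).map x) ((σ U i).map y) (act (π ⁻¹' U.1) (y i))
  linarith

/-- An approximate partial orbit for `ρ` is an approximate partial orbit for `ρ'`. -/
theorem tupleDist_two_act_le [MeasurableGrpd H] (hπ : IsClassBijectiveFactor π)
    (hb : BddAbove (range fun p : Obj G × Obj G => ρ p.1 p.2))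
    (hb' : BddAbove (range fun p : Obj G × Obj G => ρ' p.1 p.2))
    {S : Finset (PartialAut H)} {τ η : ℝ} (hτ : 0 < τ) (hτρ : τ ≤ pdiam ρ) (hη : 0 ≤ η)
    (hS : ∀ x y : Obj G, (∀ U ∈ S, extDist ρ (act (π ⁻¹' U.1) x) (act (π ⁻¹' U.1) y) < τ) →
      ρ' x y < η)
    {n : ℕ} (hn : 0 < n) {σ : SoficMap H n} {x : Fin n → Obj G} {r : ℝ} (hr : 0 ≤ r)
    {f : PartialAut H}
    (hf : tupleDist ρ .two (fun i => act (π ⁻¹' f.1) (x i)) (fun i => (σ f i).map x) ≤ r)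
    (hU : ∀ U ∈ S, tupleDist ρ .two (fun i => act (π ⁻¹' U.1) (x i))
      (fun i => (σ U i).map x) ≤ r)
    (hUf : ∀ U ∈ S, tupleDist ρ .two (fun i => act (π ⁻¹' (U * f).1) (x i))
      (fun i => (σ (U * f) i).map x) ≤ r)
    (hσ : ∀ U ∈ S, normCard n (symmDiff (graph (σ (U * f))) (graph ((σ f).trans (σ U)))) ≤ r) :
    tupleDist ρ' .two (fun i => act (π ⁻¹' f.1) (x i)) (fun i => (σ f i).map x) ≤
      Real.sqrt (η ^ 2 + pdiam ρ' ^ 2 *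
        ((r / τ) ^ 2 + S.card * (2 * (r / (τ / 2)) ^ 2 + r))) := by
  classical
  have hτ2 : 0 < τ / 2 := by positivity
  have hn' : (0 : ℝ) < n := by exact_mod_cast hn
  -- Bad coordinates: `B₀` for `f`; for each `U`, `B₁` for the product `U * f`, `B₂` where
  -- multiplicativity fails, and `B₃` where `σ f` leads to a coordinate at which `U` is badly
  -- followed.
  let B₀ : Finset (Fin n) := {i | τ ≤ extDist ρ (act (π ⁻¹' f.1) (x i)) ((σ f i).map x)}
  let D : PartialAut H → Finset (Fin n) := fun U =>
    {i | τ / 2 ≤ extDist ρ (act (π ⁻¹' U.1) (x i)) ((σ U i).map x)}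
  let B₁ : PartialAut H → Finset (Fin n) := fun U =>
    {i | τ / 2 ≤ extDist ρ (act (π ⁻¹' (U * f).1) (x i)) ((σ (U * f) i).map x)}
  let B₂ : PartialAut H → Finset (Fin n) := fun U =>
    {i | σ (U * f) i ≠ (σ f).trans (σ U) i}
  let B₃ : PartialAut H → Finset (Fin n) := fun U => {i | ∃ j ∈ D U, σ f i = some j}
  have h0 : (B₀.card : ℝ) ≤ (r / τ) ^ 2 * n := card_le_of_tupleDist_two_le hτ hf
  have hcard : ∀ U ∈ S, ((B₁ U ∪ B₂ U ∪ B₃ U).card : ℝ) ≤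
      (2 * (r / (τ / 2)) ^ 2 + r) * n := by
    intro U hUS
    have h1 : ((B₁ U).card : ℝ) ≤ _ := card_le_of_tupleDist_two_le hτ2 (hUf U hUS)
    have h2 : ((B₂ U).card : ℝ) ≤ r * n := by
      refine le_trans (Nat.cast_le.2 (card_ne_le_ncard _ _)) ?_
      exact (div_le_iff₀ hn').1 (hσ U hUS)
    have h3 : ((B₃ U).card : ℝ) ≤ (D U).card := by exact_mod_cast card_preimage_le (σ f) (D U)
    have h4 : ((D U).card : ℝ) ≤ _ := card_le_of_tupleDist_two_le hτ2 (hU U hUS)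
    have h5 : ((B₁ U ∪ B₂ U ∪ B₃ U).card : ℝ) ≤ (B₁ U).card + (B₂ U).card + (B₃ U).card := by
      exact_mod_cast (Finset.card_union_le _ _).trans
        (Nat.add_le_add_right (Finset.card_union_le _ _) _)
    linarith
  refine tupleDist_two_le hb' (by positivity)
    (B := B₀ ∪ S.biUnion fun U => B₁ U ∪ B₂ U ∪ B₃ U) ?_ fun i hi => ?_
  · have h5 : ((B₀ ∪ S.biUnion fun U => B₁ U ∪ B₂ U ∪ B₃ U).card : ℝ) ≤
        B₀.card + (S.biUnion fun U => B₁ U ∪ B₂ U ∪ B₃ U).card := by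
      exact_mod_cast Finset.card_union_le _ _
    have h6 := card_biUnion_le_mul S _ hcard
    linarith
  · simp only [Finset.mem_union, Finset.mem_biUnion, not_or, not_exists, not_and] at hi
    obtain ⟨hi0, hiS⟩ := hi
    have hi0' : extDist ρ (act (π ⁻¹' f.1) (x i)) ((σ f i).map x) < τ := by
      simpa [B₀] using hi0
    rcases ea : act (π ⁻¹' f.1) (x i) with _ | a <;> rcases eb : σ f i with _ | j
    · exact (extDist_self (ρ := ρ') _).trans_le hη
    -- If exactly one side is `*`, their distance is the diameter, which is at least `τ`, so `i`
    -- would lie in `B₀`.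
    · rw [ea, eb] at hi0'
      exact absurd hi0' (not_lt.2 hτρ)
    · rw [ea, eb] at hi0'
      exact absurd hi0' (not_lt.2 hτρ)
    · refine (hS a (x j) fun U hUS => ?_).le
      obtain ⟨⟨h1, h2⟩, h3⟩ := hiS U hUS
      have h1' : extDist ρ (act (π ⁻¹' (U * f).1) (x i)) ((σ (U * f) i).map x) < τ / 2 := by
        simpa [B₁] using h1
      have h2' : σ (U * f) i = (σ f i).bind (σ U) := by
        by_contra hne
        exact h2 (Finset.mem_filter.2 ⟨Finset.mem_univ _, hne⟩)
      have h3' : extDist ρ (act (π ⁻¹' U.1) (x j)) ((σ U j).map x) < τ / 2 := by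
        by_contra! hcon
        exact h3 (Finset.mem_filter.2 ⟨Finset.mem_univ _, j,
          Finset.mem_filter.2 ⟨Finset.mem_univ _, hcon⟩, eb⟩)
      -- Both `U·(f·x_i)` and `U·x_{σ(f)i}` are within `τ / 2` of `x_{σ(U)σ(f)i}`.
      rw [act_preimage_mul hπ, h2', ea, eb, Option.bind_some, Option.bind_some] at h1'
      rw [extDist_comm] at h3'
      have := extDist_triangle hb (act (π ⁻¹' U.1) a) ((σ U j).map x) (act (π ⁻¹' U.1) (x j))
      linarith

end ChangeOfMetric

theorem Orb_subset_Orb {G : Type u} {H : Type v} [Grpd G] [TopologicalSpace H] [MeasurableSpace H]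
    [Grpd H] {ν : Measure (Obj H)} {π : G → H} (hπ : IsMorphism π) {n : ℕ} {σ : SoficMap H n}
    {F F' : Finset (PartialAut H)} (hF : F ⊆ F') {δ δ' : ℝ} (hδ : δ' ≤ δ)
    (K : Finset C(Obj H, ℂ)) (ρ : PseudoMetric (Obj G) ℝ) :
    Orb ν hπ σ F' K δ' ρ ⊆ Orb ν hπ σ F K δ ρ :=
  fun _ hx => ⟨fun f hf => (hx.1 f (hF hf)).trans_le hδ, fun k hk => (hx.2 k hk).trans_le hδ⟩

/-- The degenerate case, in which `*` cannot be told from a point: a generating pseudo-metric of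
diameter zero forces `G⁰` to have at most one point. -/
theorem IsDynGenerating.eq_of_pdiam_eq_zero {G : Type u} {H : Type v} [Grpd G] [TopologicalSpace H]
    [Grpd H] {π : G → H} {ρ ρ' : PseudoMetric (Obj G) ℝ}
    (hb : BddAbove (range fun p : Obj G × Obj G => ρ p.1 p.2))
    (hgen : IsDynGenerating π ρ) (h0 : pdiam ρ = 0) : ρ = ρ' := by
  have hsub : ∀ x y : Obj G, x = y := fun x y => by
    by_contra hne
    obtain ⟨U, -, h⟩ := hgen x y hne
    exact absurd (h.trans_le (extDist_le_pdiam hb _ _)) (by rw [h0]; exact lt_irrefl 0)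
  refine DFunLike.ext _ _ fun x => funext fun y => ?_
  rw [hsub x y, PseudoMetric.refl, PseudoMetric.refl]

/-! ### Comparison of the entropies of two generating pseudo-metrics. -/

section Main

variable {G : Type u} {H : Type v} [TopologicalSpace G] [Grpd G] [TopologicalGrpd G]
    [CompactSpace (Obj G)] [TopologicalSpace H] [Grpd H] [MeasurableSpace H] [BorelSpace H]
    {ν : Measure (Obj H)} {π : G → H} {ρ ρ' : PseudoMetric (Obj G) ℝ}

/-- The same `r` bounds the orbit tolerance and is the new separation scale: two approximate orbits
within `r` in `ρ₂` would be less than `ε` apart in `ρ'₂`. -/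
theorem exists_sepNumber_Orb_le (hG : IsEtale G) (hπc : Continuous π)
    (hπ : IsClassBijectiveFactor π) (hρ : IsContinuous ρ) (hρ' : IsContinuous ρ')
    (hgen : IsDynGenerating π ρ) {ε : ℝ} (hε : 0 < ε) :
    ∃ (S : Finset (PartialAut H)) (r : ℝ), (∀ U ∈ S, IsFullBisection U.1) ∧ 0 < r ∧
      ∀ (n : ℕ) (σ : SoficMap H n) (F : Finset (PartialAut H)) (K : Finset C(Obj H, ℂ)) (δ : ℝ),
        S ⊆ F → δ ≤ r → ∀ X ⊆ Orb ν hπ.toIsMorphism σ F K δ ρ,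
        sepNumber (fun x y : Fin n → Obj G =>
          tupleDist ρ' .two (fun i => some (x i)) (fun i => some (y i))) ε X ≤
        sepNumber (fun x y : Fin n → Obj G =>
          tupleDist ρ .two (fun i => some (x i)) (fun i => some (y i))) r X := by
  obtain ⟨η, hη, θ, hθ, hs⟩ := exists_sqrt_lt (pdiam ρ') hε
  obtain ⟨S, τ, hτ, hSF, hS⟩ := hgen.exists_finset hG hπc hπ hρ hρ' hη
  obtain ⟨r, hr, hrθ⟩ := exists_pos_le_of_continuous
    (c := fun r => S.card * (3 * (r / (τ / 3)) ^ 2)) (by fun_prop) (by simp) hθ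
  refine ⟨S, r, hSF, hr, fun n σ F K δ hSF hδ X hX =>
    sepNumber_le_sepNumber subset_rfl fun x hx y hy hxy => ?_⟩
  by_contra! hcon
  have h := tupleDist_two_le_of_close hρ.bddAbove hρ'.bddAbove hτ hS
    (fun U hU => ((hX hx).1 U (hSF hU)).le.trans hδ)
    (fun U hU => ((hX hy).1 U (hSF hU)).le.trans hδ) hcon
  linarith [hs _ hrθ]

theorem exists_Orb_subset [T2Space H] [CompactSpace (Obj H)] [TopologicalGrpd H]
    [MeasurableGrpd H] (hν : IsPMP H ν) (hG : IsEtale G) (hπc : Continuous π)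
    (hπ : IsClassBijectiveFactor π) (hρ : IsContinuous ρ) (hρ' : IsContinuous ρ')
    (hgen : IsDynGenerating π ρ) (hdiam : 0 < pdiam ρ) {δ' : ℝ} (hδ' : 0 < δ')
    {F' : Finset (PartialAut H)} (hF' : ∀ f ∈ F', IsTop ν f) :
    ∃ (δ : ℝ) (F : Finset (PartialAut H)), 0 < δ ∧ (∀ f ∈ F, IsTop ν f) ∧
      ∀ (n : ℕ) (σ : SoficMap H n) (K : Finset C(Obj H, ℂ)), 0 < n → IsMultiplicative F δ σ →
        Orb ν hπ.toIsMorphism σ F K δ ρ ⊆ Orb ν hπ.toIsMorphism σ F' K δ' ρ' := by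
  classical
  obtain ⟨η, hη, θ, hθ, hs⟩ := exists_sqrt_lt (pdiam ρ') hδ'
  obtain ⟨S, τ₀, hτ₀, hSF, hS₀⟩ := hgen.exists_finset hG hπc hπ hρ hρ' hη
  -- Capping `τ` at the diameter ensures that points at distance below `τ` are both `*` or both
  -- genuine.
  set τ := min τ₀ (pdiam ρ) with hτdef
  have hτ : 0 < τ := lt_min hτ₀ hdiam
  have hS : ∀ x y : Obj G, (∀ U ∈ S, extDist ρ (act (π ⁻¹' U.1) x) (act (π ⁻¹' U.1) y) < τ) →
      ρ' x y < η := fun x y h => hS₀ x y fun U hU => (h U hU).trans_le (min_le_left _ _)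
  obtain ⟨r, hr, hrθ⟩ := exists_pos_le_of_continuous
    (c := fun r => (r / τ) ^ 2 + S.card * (2 * (r / (τ / 2)) ^ 2 + r))
    (by fun_prop) (by simp) hθ
  set δ := min r δ' with hδdef
  have hδ : 0 < δ := lt_min hr hδ'
  have hδr : δ ≤ r := min_le_left _ _
  -- The orbit must follow `f`, `U` and `U * f`, and `σ` must be multiplicative on the pairs `(U,
  -- f)`. The family `K` is unchanged, as its condition does not involve the pseudo-metric.
  refine ⟨δ, F' ∪ S ∪ Finset.image₂ (· * ·) S F', hδ, fun f hf => ?_,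
    fun n σ K hn hσ x hx => ⟨fun f hf => ?_, fun k hk => (hx.2 k hk).trans_le (min_le_right _ _)⟩⟩
  · simp only [Finset.mem_union, Finset.mem_image₂] at hf
    rcases hf with (hf | hf) | ⟨U, hU, f', hf', rfl⟩
    · exact hF' f hf
    · exact (hSF f hf).isTop ν
    · exact (hF' f' hf').full_mul hν (hSF U hU)
  · have m1 : ∀ {g}, g ∈ F' → g ∈ F' ∪ S ∪ Finset.image₂ (· * ·) S F' := fun hg =>
      Finset.mem_union_left _ (Finset.mem_union_left _ hg)
    have m2 : ∀ {g}, g ∈ S → g ∈ F' ∪ S ∪ Finset.image₂ (· * ·) S F' := fun hg =>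
      Finset.mem_union_left _ (Finset.mem_union_right _ hg)
    have m3 : ∀ {U}, U ∈ S → U * f ∈ F' ∪ S ∪ Finset.image₂ (· * ·) S F' := fun hU =>
      Finset.mem_union_right _ (Finset.mem_image₂_of_mem hU hf)
    exact (tupleDist_two_act_le hπ hρ.bddAbove hρ'.bddAbove hτ (min_le_right _ _) hη.le hS hn
      hr.le ((hx.1 f (m1 hf)).le.trans hδr) (fun U hU => (hx.1 U (m2 hU)).le.trans hδr)
      (fun U hU => (hx.1 (U * f) (m3 hU)).le.trans hδr)
      (fun U hU => (hσ U (m2 hU) f (m1 hf)).le.trans hδr)).trans_lt (hs _ hrθ)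

theorem entropy_two_le_entropy_two [T2Space H] [CompactSpace (Obj H)] [TopologicalGrpd H]
    [MeasurableGrpd H] (hν : IsPMP H ν) (hG : IsEtale G) (hπc : Continuous π)
    (hπ : IsClassBijectiveFactor π) {J : Type*} [Preorder J] [IsDirectedOrder J] [Nonempty J]
    {d : J → ℕ} {P : ∀ j, Measure (SoficMap H (d j))} (hP : IsSoficApproximation ν d P)
    (β : Bias J) (p : ℝ≥0∞) (hρ : IsContinuous ρ) (hρ' : IsContinuous ρ')
    (hgen : IsDynGenerating π ρ) (hgen' : IsDynGenerating π ρ') :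
    entropy ν d P β p hπ.toIsMorphism ρ .two ≤ entropy ν d P β p hπ.toIsMorphism ρ' .two := by
  classical
  rcases (pdiam_nonneg ρ).eq_or_lt with h0 | hdiam
  · rw [hgen.eq_of_pdiam_eq_zero (ρ' := ρ') hρ.bddAbove h0.symm]
  refine entropy_le_entropy hP.tendsto_size β p _ fun ε hε κ hκ => ?_
  -- The roles are exchanged here: `ρ'` generates, so `ε`-separation in `ρ` on orbits for `ρ'`
  -- becomes `r`-separation in `ρ'`.
  obtain ⟨S, r, hSF, hr, hsep⟩ := exists_sepNumber_Orb_le (ν := ν) hG hπc hπ hρ' hρ hgen' hε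
  refine ⟨r, hr, fun δ' hδ' F' hF' K => ?_⟩
  -- Enlarging `F'` by `S` and capping `δ'` at `r` puts the orbits for `ρ` inside orbits for `ρ'` to
  -- which `hsep` applies.
  obtain ⟨δ, F, hδ, hF, hsub⟩ := exists_Orb_subset hν hG hπc hπ hρ hρ' hgen hdiam
    (lt_min hδ' hr) (F' := F' ∪ S) fun f hf => (Finset.mem_union.1 hf).elim (hF' f)
      fun h => (hSF f h).isTop ν
  refine ⟨δ, hδ, F, hF, K, ?_⟩
  obtain ⟨j₀, hj₀⟩ := hP.multiplicative F δ hδ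
  filter_upwards [eventually_ge_atTop j₀] with j hj hdj
  filter_upwards [hj₀ j hj] with σ hσ
  refine le_trans ?_ (le_mul_of_one_le_left zero_le (one_le_ofReal_exp hκ _))
  have h1 := hsub (d j) σ K hdj hσ
  refine ENat.toENNReal_mono ((hsep (d j) σ (F' ∪ S) K _ Finset.subset_union_right
    (min_le_right _ _) _ h1).trans (sepNumber_le_sepNumber ?_ fun x _ y _ h => h))
  exact h1.trans (Orb_subset_Orb _ Finset.subset_union_left (min_le_left _ _) K ρ')

end Main

end SoficEntropy

theorem theorem6p7
    {G H : Type*}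
    [TopologicalSpace G] [Grpd G] [TopologicalGrpd G] [TopologicalSpace.SeparableSpace G]
    [CompactSpace (Obj G)] [TopologicalSpace.MetrizableSpace (Obj G)]
    [TopologicalSpace H] [Grpd H] [TopologicalGrpd H] [TopologicalSpace.SeparableSpace H]
    [T2Space H] [CompactSpace (Obj H)] [TopologicalSpace.MetrizableSpace (Obj H)]
    [MeasurableSpace H] [BorelSpace H] [MeasurableGrpd H]
    (hG : IsDiscreteGrpd G)
    (ν : Measure (Obj H)) (hν : IsPMP H ν)
    (π : G → H) (hπc : Continuous π) (hπ : IsClassBijectiveFactor π)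
    {J : Type*} [Preorder J] [IsDirectedOrder J] [Nonempty J]
    (d : J → ℕ) (P : ∀ j, Measure (SoficMap H (d j))) (hP : IsSoficApproximation ν d P)
    (β : Bias J) (p : ℝ≥0∞) (hp : 1 ≤ p)
    (hGet : IsEtale G)
    (ρ₁ ρ₂ : PseudoMetric (Obj G) ℝ)
    (hc₁ : IsContinuous ρ₁) (hc₂ : IsContinuous ρ₂)
    (hg₁ : IsDynGenerating π ρ₁) (hg₂ : IsDynGenerating π ρ₂)
    (q₁ q₂ : TupleDist) :
    entropy ν d P β p hπ.toIsMorphism ρ₁ q₁ = entropy ν d P β p hπ.toIsMorphism ρ₂ q₂ := by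
  rw [entropy_eq_entropy_two hP.tendsto_size β p _ hc₁ q₁,
    entropy_eq_entropy_two hP.tendsto_size β p _ hc₂ q₂]
  exact le_antisymm
    (entropy_two_le_entropy_two hν hGet hπc hπ hP β p hc₁ hc₂ hg₁ hg₂)
    (entropy_two_le_entropy_two hν hGet hπc hπ hP β p hc₂ hc₁ hg₂ hg₁)
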